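/- A $k$-spanner of a finite simple undirected unweighted graph $G=(V,E)$ is a subgraph $H=(V,E')$, $E'\subseteq E$, with $\mathrm{dist}_H(u,v)\le k\cdot \mathrm{dist}_G(u,v)$ for all $u,v\in V$ (distances between different components are $\infty$); it is a minimum $k$-spanner if no $k$-spanner of $G$ has fewer edges. The girth of a graph is the length of its shortest cycle, and $\infty$ for a forest. **Theorem.** There are a deterministic algorithm $A$, whose running time is polynomial in the number $n$ of vertices on every input $(G,H,k)$ consisting of two graphs $G,H$ on the same $n$ vertices and an integer $k\ge 0$, and constants $c$ and $N$ such that for all integers $n\ge N$ and $k>\tfrac34 n+c$ the following hold. 1. For every $n$-vertex graph $G$ and every $k$-spanner $H$ of $G$, $A(G,H,k)$ outputs a subgraph $R\subseteq H$ that is a $k$-spanner of $G$ and has girth at least $k+2$. 2. The pair $(n,k)$ is extremely good: for every $n$-vertex graph $G$, every minimum $k$-spanner of $G$ has girth at least $k+2$. Running time is counted in steps of a random-access machine with unit-cost addition, truncated subtraction, zero tests and indirect memory access on natural numbers; the graphs are given and returned as adjacency matrices. -/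

import Mathlib

/-! ### Spanners, girth, extremely good pairs

All graphs are finite, simple, undirected and unweighted. `SimpleGraph.edist` is the graph distance
with values in `ℕ∞` (it is `⊤` between different components), and `SimpleGraph.egirth` is the girth
with values in `ℕ∞` (it is `⊤` for a forest). -/

/-- `H` is a `k`-spanner of `G`: a subgraph on the same vertex set with
`dist_H(u,v) ≤ k * dist_G(u,v)` for all vertices `u`, `v`. -/
def IsSpanner {V : Type*} (k : ℕ) (G H : SimpleGraph V) : Prop :=
  H ≤ G ∧ ∀ u v : V, H.edist u v ≤ (k : ℕ∞) * G.edist u v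

/-- `H` is a minimum `k`-spanner of `G`: a `k`-spanner with the fewest edges. -/
def IsMinSpanner {V : Type*} (k : ℕ) (G H : SimpleGraph V) : Prop :=
  IsSpanner k G H ∧
    ∀ H' : SimpleGraph V, IsSpanner k G H' → H.edgeSet.ncard ≤ H'.edgeSet.ncard

/-- `(n, k)` is extremely good: for every `n`-vertex graph, all of its minimum `k`-spanners have
girth at least `k + 2`. -/
def IsExtremelyGood (n k : ℕ) : Prop :=
  ∀ (V : Type) [Fintype V], Fintype.card V = n →
    ∀ G H : SimpleGraph V, IsMinSpanner k G H → ((k + 2 : ℕ) : ℕ∞) ≤ H.egirth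

/-! ### Deterministic random-access machine with a step count

The machine has registers `reg 0, reg 1, …` and an addressable memory `mem 0, mem 1, …`, all holding
natural numbers. A program is a finite term, so it mentions finitely many registers. Every
elementary instruction and every test costs one step. The only arithmetic is addition and truncated
subtraction, so that `t` steps lengthen the binary representation of the largest number present by
at most `O(t)` bits, and polynomially many steps are polynomial time on a Turing machine. -/

namespace RAM

/-- The contents of the registers and of the memory. -/
structure State where
  reg : ℕ → ℕ
  mem : ℕ → ℕ

/-- Programs, in structured form. -/
inductive Prog : Type
  /-- do nothing -/
  | skip : Prog
  /-- `reg d := c` -/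
  | const (d c : ℕ) : Prog
  /-- `reg d := reg a + reg b` -/
  | add (d a b : ℕ) : Prog
  /-- `reg d := max (reg a - reg b) 0` -/
  | sub (d a b : ℕ) : Prog
  /-- `reg d := mem (reg a)` -/
  | load (d a : ℕ) : Prog
  /-- `mem (reg a) := reg b` -/
  | store (a b : ℕ) : Prog
  /-- first `P`, then `Q` -/
  | seq (P Q : Prog) : Prog
  /-- if `reg r ≠ 0` then `P` else `Q` -/
  | ite (r : ℕ) (P Q : Prog) : Prog
  /-- while `reg r ≠ 0` do `P` -/
  | loop (r : ℕ) (P : Prog) : Prog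

/-- Write `x` into register `d`. -/
def State.setReg (s : State) (d x : ℕ) : State :=
  { s with reg := Function.update s.reg d x }

/-- Write `x` into memory cell `a`. -/
def State.setMem (s : State) (a x : ℕ) : State :=
  { s with mem := Function.update s.mem a x }

/-- `Exec P s t s'`: started in state `s`, the program `P` halts after exactly `t` steps, in
state `s'`. -/
inductive Exec : Prog → State → ℕ → State → Prop
  | skip (s : State) : Exec Prog.skip s 1 s
  | const (d c : ℕ) (s : State) : Exec (Prog.const d c) s 1 (s.setReg d c)
  | add (d a b : ℕ) (s : State) : Exec (Prog.add d a b) s 1 (s.setReg d (s.reg a + s.reg b))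
  | sub (d a b : ℕ) (s : State) : Exec (Prog.sub d a b) s 1 (s.setReg d (s.reg a - s.reg b))
  | load (d a : ℕ) (s : State) : Exec (Prog.load d a) s 1 (s.setReg d (s.mem (s.reg a)))
  | store (a b : ℕ) (s : State) : Exec (Prog.store a b) s 1 (s.setMem (s.reg a) (s.reg b))
  | seq {P Q : Prog} {s s₁ s₂ : State} {t₁ t₂ : ℕ} :
      Exec P s t₁ s₁ → Exec Q s₁ t₂ s₂ → Exec (Prog.seq P Q) s (t₁ + t₂) s₂
  | ite_true {r : ℕ} {P Q : Prog} {s s₁ : State} {t : ℕ} :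
      s.reg r ≠ 0 → Exec P s t s₁ → Exec (Prog.ite r P Q) s (t + 1) s₁
  | ite_false {r : ℕ} {P Q : Prog} {s s₁ : State} {t : ℕ} :
      s.reg r = 0 → Exec Q s t s₁ → Exec (Prog.ite r P Q) s (t + 1) s₁
  | loop_done {r : ℕ} {P : Prog} {s : State} :
      s.reg r = 0 → Exec (Prog.loop r P) s 1 s
  | loop_step {r : ℕ} {P : Prog} {s s₁ s₂ : State} {t₁ t₂ : ℕ} :
      s.reg r ≠ 0 → Exec P s t₁ s₁ → Exec (Prog.loop r P) s₁ t₂ s₂ →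
        Exec (Prog.loop r P) s (t₁ + t₂ + 1) s₂

/-- The machine is deterministic: the final state and the number of steps are unique. -/
theorem Exec.deterministic {P : Prog} {s s₁ s₂ : State} {t₁ t₂ : ℕ}
    (h₁ : Exec P s t₁ s₁) (h₂ : Exec P s t₂ s₂) : t₁ = t₂ ∧ s₁ = s₂ := by
  induction h₁ generalizing t₂ s₂ with
  | skip | const | add | sub | load | store => cases h₂; exact ⟨rfl, rfl⟩
  | seq _ _ ihP ihQ =>
    cases h₂ with
    | seq hP hQ =>
      obtain ⟨rfl, rfl⟩ := ihP hP
      obtain ⟨rfl, rfl⟩ := ihQ hQ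
      exact ⟨rfl, rfl⟩
  | ite_true hr _ ih =>
    cases h₂ with
    | ite_true _ h => obtain ⟨rfl, rfl⟩ := ih h; exact ⟨rfl, rfl⟩
    | ite_false hr' _ => exact absurd hr' hr
  | ite_false hr _ ih =>
    cases h₂ with
    | ite_true hr' _ => exact absurd hr hr'
    | ite_false _ h => obtain ⟨rfl, rfl⟩ := ih h; exact ⟨rfl, rfl⟩
  | loop_done hr =>
    cases h₂ with
    | loop_done _ => exact ⟨rfl, rfl⟩
    | loop_step hr' _ _ => exact absurd hr hr'
  | loop_step hr _ _ ihP ihQ =>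
    cases h₂ with
    | loop_done hr' => exact absurd hr' hr
    | loop_step _ hP hQ =>
      obtain ⟨rfl, rfl⟩ := ihP hP
      obtain ⟨rfl, rfl⟩ := ihQ hQ
      exact ⟨rfl, rfl⟩

open Classical in
/-- The initial state for the input `(G, H, k)`, with `G` and `H` graphs on `n` vertices: register
`0` holds `n`, register `1` holds `k`, the memory holds the `n × n` adjacency matrix of `G`, row by
row, followed by that of `H`, and everything else is `0`. -/
noncomputable def input {n : ℕ} (G H : SimpleGraph (Fin n)) (k : ℕ) : State where
  reg r := if r = 0 then n else if r = 1 then k else 0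
  mem a :=
    if ∃ i j : Fin n, (a = i.val * n + j.val ∧ G.Adj i j) ∨
        (a = n * n + (i.val * n + j.val) ∧ H.Adj i j) then 1 else 0

open Classical in
/-- The output read off from a final state is the graph `R` on `n` vertices: the first `n * n`
memory cells hold the adjacency matrix of `R`, row by row. -/
def Outputs {n : ℕ} (s : State) (R : SimpleGraph (Fin n)) : Prop :=
  ∀ i j : Fin n, s.mem (i.val * n + j.val) = if R.Adj i j then 1 else 0

end RAM

/-! Both parts rest on one statement, `IsSpanner.le_egirth`: if `3 * n < 4 * k`, then a `k`-spanner
`H` of which no single edge can be deleted has girth at least `k + 2`. A minimum spanner is of this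
kind, and deleting superfluous edges one by one leads to one; so `c = 0` and `N = 0` suffice.

Suppose a shortest cycle `C` of `H` has length `g ≤ k + 1`, and let `B` be its path hull. Whatever
is attached to `B` hangs at single vertices `v` of `B`, in disjoint branches with `h v` further
vertices, so `∑ h v + |B| ≤ n`. For each edge `e` of `C`, some edge of `G` is spanned by a path of
length at most `k` in `H` but by none in `H - e`. The vertices where such a path enters and leaves
`B` form a pair `u, w` whose distance `D` in `H - e` exceeds the one in `H` and satisfies `k + 1 ≤ h
u + h w + D` (`exists_dist_lt_of_lt_length`). No vertex lies in the pairs of all edges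
(`exists_edge_not_dist_lt`), so two pairs are disjoint or the pairs are the sides of a triangle
(`Finset.disjoint_pairs_or_triangle`).

If `B` is larger than `C`, then `4 * D ≤ 3 * |B|` (`four_mul_dist_le`), as the sum of `2 * D ≤ |B| +
g`, which counts distance layers, and `2 * D + g ≤ 2 * |B|`, which uses a second cycle avoiding `e`.
Adding the inequalities of two disjoint pairs, or of the three sides, gives `4 * (k + 1) ≤ 3 * n`.
If `B = C`, then `D` is at most the length of the arc avoiding `e`; the branches must therefore be
large enough to cover all edges of `C`, and a similar count applies.

The algorithm tries each edge of `H` once, testing the stretch by computing all distances. An edge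
found necessary stays necessary, because the current graph only shrinks. -/

namespace SimpleGraph

variable {V : Type*} {G : SimpleGraph V}

/-! ### Splitting walks -/

/-- A walk ending in `S` has a shortest initial segment that ends in `S`. -/
theorem Walk.exists_first_mem {S : Set V} {x y : V} (p : G.Walk x y) (hy : y ∈ S) :
    ∃ u ∈ S, ∃ (q : G.Walk x u) (r : G.Walk u y), p = q.append r ∧
      ∀ z ∈ q.support, z ∈ S → z = u := by
  induction p with
  | nil => exact ⟨_, hy, .nil, .nil, rfl, by simp⟩
  | @cons a b c h p ih =>
    by_cases ha : a ∈ S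
    · exact ⟨a, ha, .nil, .cons h p, rfl, by simp⟩
    · obtain ⟨u, hu, q, r, rfl, hq⟩ := ih hy
      refine ⟨u, hu, .cons h q, r, rfl, fun z hz hzS => ?_⟩
      rw [Walk.support_cons, List.mem_cons] at hz
      rcases hz with rfl | hz
      · exact absurd hzS ha
      · exact hq z hz hzS

/-- A walk through the edge `ab` crosses it in one of the two directions. -/
theorem Walk.exists_append_cons_of_mem_edges {x y a b : V} (p : G.Walk x y)
    (h : s(a, b) ∈ p.edges) :
    (∃ (hab : G.Adj a b) (q : G.Walk x a) (r : G.Walk b y), p = q.append (.cons hab r)) ∨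
    (∃ (hba : G.Adj b a) (q : G.Walk x b) (r : G.Walk a y), p = q.append (.cons hba r)) := by
  induction p with
  | nil => simp at h
  | @cons u v w huv p ih =>
    rw [Walk.edges_cons, List.mem_cons] at h
    rcases h with h | h
    · rw [Sym2.eq_iff] at h
      rcases h with ⟨rfl, rfl⟩ | ⟨rfl, rfl⟩
      · exact .inl ⟨huv, .nil, p, rfl⟩
      · exact .inr ⟨huv, .nil, p, rfl⟩
    · rcases ih h with ⟨hab, q, r, rfl⟩ | ⟨hab, q, r, rfl⟩
      · exact .inl ⟨hab, .cons huv q, r, rfl⟩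
      · exact .inr ⟨hab, .cons huv q, r, rfl⟩

theorem Walk.IsPath.disjoint_of_append {x y z : V} {p : G.Walk x y} {q : G.Walk y z}
    (h : (p.append q).IsPath) {v : V} (hp : v ∈ p.support) (hq : v ∈ q.support) : v = y := by
  rw [Walk.isPath_def, Walk.support_append, List.nodup_append] at h
  rw [Walk.mem_support_iff] at hq
  rcases hq with hq | hq
  · exact hq
  · exact absurd rfl (h.2.2 v hp v hq)

theorem Walk.transfer_of_forall {K : SimpleGraph V} {x y : V} (p : G.Walk x y)
    (h : ∀ a b, s(a, b) ∈ p.edges → K.Adj a b) :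
    ∃ q : K.Walk x y, q.length = p.length ∧ q.support = p.support ∧ q.edges = p.edges :=
  have h' : ∀ e ∈ p.edges, e ∈ K.edgeSet := fun e => by
    induction e with | _ a b => exact h a b
  ⟨p.transfer K h', by simp, by simp, by simp⟩

/-! ### Path-closed sets and hulls -/

/-- Every path with both ends in `S` stays in `S`. -/
def PathClosed (G : SimpleGraph V) (S : Set V) : Prop :=
  ∀ u ∈ S, ∀ w ∈ S, ∀ p : G.Walk u w, p.IsPath → ∀ x ∈ p.support, x ∈ S

/-- The smallest path-closed set containing `C`. -/
def pathHull (G : SimpleGraph V) (C : Set V) : Set V :=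
  ⋂₀ {S | PathClosed G S ∧ C ⊆ S}

theorem pathClosed_pathHull (C : Set V) : PathClosed G (pathHull G C) :=
  fun u hu w hw p hp x hx S hS => hS.1 u (hu S hS) w (hw S hS) p hp x hx

theorem subset_pathHull (C : Set V) : C ⊆ pathHull G C :=
  fun _ hx _ hS => hS.2 hx

theorem pathHull_subset {C S : Set V} (hS : PathClosed G S) (h : C ⊆ S) : pathHull G C ⊆ S :=
  fun _ hx => hx S ⟨hS, h⟩

/-- A subset of the hull that contains `C` and can only be left through a single vertex is the
whole hull. -/
theorem pathHull_subset_of_separator {C A : Set V} (hAB : A ⊆ pathHull G C) (hCA : C ⊆ A) (z : V)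
    (hz : ∀ x ∈ A, ∀ y ∈ pathHull G C, y ∉ A → G.Adj x y → x = z) : pathHull G C ⊆ A := by
  classical
  refine pathHull_subset (fun u hu w hw p hp v hv => ?_) hCA
  by_contra hvA
  have hB : ∀ x ∈ p.support, x ∈ pathHull G C :=
    pathClosed_pathHull C u (hAB hu) w (hAB hw) p hp
  have key : ∀ (u : V) (q : G.Walk u v), u ∈ A → (∀ x ∈ q.support, x ∈ pathHull G C) →
      z ∈ q.support ∧ z ∈ A := by
    intro u q hu hq
    obtain ⟨d, hd, h1, h2⟩ := q.exists_boundary_dart A hu hvA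
    have := hz d.fst h1 d.snd (hq _ (Walk.dart_snd_mem_support_of_mem_darts _ hd)) h2 d.adj
    exact this ▸ ⟨Walk.dart_fst_mem_support_of_mem_darts _ hd, h1⟩
  obtain ⟨q, r, rfl⟩ := Walk.mem_support_iff_exists_append.1 hv
  have h1 := key u q hu fun x hx => hB x (by simp [Walk.mem_support_append_iff, hx])
  have h2 := key w r.reverse hw fun x hx => hB x (by
    rw [Walk.support_reverse, List.mem_reverse] at hx
    simp [Walk.mem_support_append_iff, hx])
  -- Both halves of the path cross from `A` to `v` through `z`; a path visits `z` only once, so `z =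
  -- v`.
  have := hp.disjoint_of_append h1.1 (by simpa using h2.1)
  exact hvA (this ▸ h1.2)

theorem reachable_of_mem_pathHull {C : Set V} {a x : V} (hC : ∀ c ∈ C, G.Reachable a c)
    (hx : x ∈ pathHull G C) : G.Reachable a x := by
  classical
  refine pathHull_subset (S := {x | G.Reachable a x}) (fun u hu w hw p hp v hv => ?_) hC hx
  exact Reachable.trans hu (p.takeUntil v hv).reachable

/-! ### Branches hanging at a path-closed set -/

/-- The graph without the edges that have both ends in `B`. -/
def outside (G : SimpleGraph V) (B : Set V) : SimpleGraph V where
  Adj x y := G.Adj x y ∧ ¬ (x ∈ B ∧ y ∈ B)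
  symm := ⟨fun _ _ h => ⟨h.1.symm, fun h' => h.2 ⟨h'.2, h'.1⟩⟩⟩
  loopless := ⟨fun x h => G.loopless.irrefl x h.1⟩

theorem outside_le (B : Set V) : outside G B ≤ G := fun _ _ h => h.1

theorem Walk.exists_outside {B : Set V} {x u : V} (q : G.Walk x u)
    (h : ∀ z ∈ q.support, z ∈ B → z = u) :
    ∃ q' : (outside G B).Walk x u, q'.length = q.length ∧ q'.support = q.support ∧
      q'.edges = q.edges := by
  refine q.transfer_of_forall fun a b hab => ⟨q.adj_of_mem_edges hab, fun hB => ?_⟩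
  have ha := h a (q.fst_mem_support_of_mem_edges hab) hB.1
  have hb := h b (q.snd_mem_support_of_mem_edges hab) hB.2
  exact (q.adj_of_mem_edges hab).ne (ha.trans hb.symm)

/-- A path joining two vertices of `B` stays in `B`, so its first edge would have both ends in `B`.
This makes the branches disjoint. -/
theorem PathClosed.eq_of_reachable_outside {B : Set V} (hB : PathClosed G B) {u w : V}
    (hu : u ∈ B) (hw : w ∈ B) (h : (outside G B).Reachable u w) : u = w := by
  obtain ⟨p, hp⟩ := h.exists_isPath
  have := hB u hu w hw (p.mapLe (outside_le B)) (hp.mapLe _)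
  rw [Walk.support_mapLe_eq_support] at this
  cases p with
  | nil => rfl
  | cons hadj p => exact absurd ⟨hu, this _ (by simp)⟩ hadj.2

/-- The number of vertices other than `v` of the branch hanging at `v`. -/
noncomputable def branchSize (G : SimpleGraph V) (B : Set V) (v : V) : ℕ :=
  {z | (outside G B).Reachable v z ∧ z ≠ v}.ncard

/-- The vertices of the path other than `u` are distinct and belong to the branch at `u`. -/
theorem Walk.IsPath.length_le_branchSize [Finite V] {B : Set V} {x u : V} {q : G.Walk x u}
    (hq : q.IsPath) (h : ∀ z ∈ q.support, z ∈ B → z = u) : q.length ≤ branchSize G B u := by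
  classical
  obtain ⟨q', h1, h2, -⟩ := q.exists_outside h
  have hnd : q.support.Nodup := hq.support_nodup
  have hsub : (q.support.toFinset.erase u : Set V) ⊆
      {z | (outside G B).Reachable u z ∧ z ≠ u} := by
    intro z hz
    simp only [Finset.coe_erase, List.coe_toFinset, Set.mem_sdiff, Set.mem_ofPred_eq,
      Set.mem_singleton_iff] at hz
    exact ⟨(q'.dropUntil z (by rw [h2]; exact hz.1)).reachable.symm, hz.2⟩
  have := Set.ncard_le_ncard hsub (Set.toFinite _)
  rw [Set.ncard_coe_finset, Finset.card_erase_of_mem (by simp), List.toFinset_card_of_nodup hnd,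
    Walk.length_support] at this
  simpa [branchSize] using this

theorem PathClosed.sum_branchSize_add_card_le [Fintype V] {B : Finset V}
    (hB : PathClosed G (B : Set V)) :
    ∑ v ∈ B, branchSize G B v + B.card ≤ Fintype.card V := by
  classical
  have h1 : ∑ v ∈ B, branchSize G B v + B.card =
      ∑ v ∈ B, (Finset.univ.filter fun z => (outside G (B : Set V)).Reachable v z).card := by
    rw [Finset.card_eq_sum_ones, ← Finset.sum_add_distrib]
    refine Finset.sum_congr rfl fun v _ => ?_
    rw [branchSize, ← Finset.card_erase_add_one (s := Finset.univ.filter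
      fun z => (outside G (B : Set V)).Reachable v z) (a := v) (by simp)]
    rw [← Set.ncard_coe_finset]
    congr 2
    ext z
    simp [and_comm]
  rw [h1, ← Finset.card_biUnion]
  · exact Finset.card_le_univ _
  · intro u hu w hw huw
    rw [Function.onFun, Finset.disjoint_left]
    intro z hz hz'
    simp only [Finset.mem_filter, Finset.mem_univ, true_and] at hz hz'
    exact huw (hB.eq_of_reachable_outside hu hw (hz.trans hz'.symm))

end SimpleGraph

namespace SimpleGraph

variable {V : Type*} {H : SimpleGraph V}

/-! ### Deleting a single edge -/

theorem Walk.exists_deleteEdges {x y : V} {e : Sym2 V} (p : H.Walk x y) (h : e ∉ p.edges) :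
    ∃ q : (H.deleteEdges {e}).Walk x y, q.length = p.length ∧ q.support = p.support := by
  obtain ⟨q, h1, h2, -⟩ := p.transfer_of_forall (K := H.deleteEdges {e}) fun a b hab => by
    rw [deleteEdges_adj]
    exact ⟨p.adj_of_mem_edges hab, fun h' => h (h' ▸ hab)⟩
  exact ⟨q, h1, h2⟩

theorem reachable_deleteEdges {a b x y : V} (hK : (H.deleteEdges {s(a, b)}).Reachable a b)
    (h : H.Reachable x y) : (H.deleteEdges {s(a, b)}).Reachable x y := by
  obtain ⟨p⟩ := h
  induction p with
  | nil => rfl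
  | @cons u v w huv p ih =>
    refine Reachable.trans ?_ ih
    by_cases he : s(u, v) = s(a, b)
    · rw [Sym2.eq_iff] at he
      rcases he with ⟨rfl, rfl⟩ | ⟨rfl, rfl⟩
      · exact hK
      · exact hK.symm
    · exact Adj.reachable (by rw [deleteEdges_adj]; exact ⟨huv, he⟩)

theorem dist_deleteEdges_le_of_walk {x y : V} {e : Sym2 V} (p : H.Walk x y) (h : e ∉ p.edges) :
    (H.deleteEdges {e}).dist x y ≤ p.length := by
  obtain ⟨q, h1, -⟩ := p.exists_deleteEdges h
  exact h1 ▸ dist_le q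

/-- The edge `ab` is the last edge of every geodesic from `u` to `b`. -/
def IsLastEdge (H : SimpleGraph V) (u a b : V) : Prop :=
  H.dist u b = H.dist u a + 1 ∧ ∀ c, H.Adj c b → c ≠ a → H.dist u b ≤ H.dist u c

/-- If `b` had another neighbour `c` closer to `u`, then a geodesic to `c`, the edge `cb` and the
rest `r` would avoid `ab` without being longer than the geodesic from `u` to `w`. -/
theorem isLastEdge_of_dist_lt_aux {u w a b : V} (hab : H.Adj a b) (q : H.Walk u a)
    (r : H.Walk b w) (hp : (q.append (.cons hab r)).IsPath)
    (hl : (q.append (.cons hab r)).length = H.dist u w)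
    (h : H.dist u w < (H.deleteEdges {s(a, b)}).dist u w) : IsLastEdge H u a b := by
  simp only [Walk.length_append, Walk.length_cons] at hl
  have ha : a ∉ r.support := fun har => by
    rw [Walk.isPath_def, Walk.support_append, Walk.support_cons, List.tail_cons,
      List.nodup_append] at hp
    exact hp.2.2 a q.end_mem_support a har rfl
  obtain ⟨qa, hqa⟩ := (q.reachable).exists_walk_length_eq_dist
  obtain ⟨qb, hqb⟩ := (q.reachable.trans hab.reachable).exists_walk_length_eq_dist
  have h1 := dist_le (qb.append r)
  have h2 := dist_le (qa.concat hab)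
  have h3 := dist_le (q.concat hab)
  have h4 := dist_le q
  simp only [Walk.length_append, Walk.length_concat] at h1 h2 h3
  refine ⟨by omega, fun c hc hca => ?_⟩
  by_contra! hlt
  obtain ⟨s, hs⟩ := (q.reachable.trans (hab.reachable.trans hc.symm.reachable)
    ).exists_walk_length_eq_dist
  have hbs : b ∉ s.support := fun hb => by
    classical
    have := dist_le (s.takeUntil b hb)
    have := s.length_takeUntil_le_length hb
    omega
  have := dist_deleteEdges_le_of_walk (e := s(a, b)) (s.append (.cons hc r)) (by
    rw [Walk.edges_append, Walk.edges_cons, List.mem_append, List.mem_cons]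
    rintro (h' | h' | h')
    · exact hbs (s.snd_mem_support_of_mem_edges h')
    · rw [Sym2.eq_iff] at h'
      rcases h' with ⟨h', -⟩ | ⟨h', -⟩
      · exact hca h'.symm
      · exact hab.ne h'
    · exact ha (r.fst_mem_support_of_mem_edges h'))
  simp only [Walk.length_append, Walk.length_cons] at this
  omega

theorem mem_edges_of_dist_lt {u w : V} {e : Sym2 V} {p : H.Walk u w}
    (hl : p.length = H.dist u w) (h : H.dist u w < (H.deleteEdges {e}).dist u w) :
    e ∈ p.edges := by
  by_contra he
  have := dist_deleteEdges_le_of_walk p he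
  omega

theorem isLastEdge_of_dist_lt {u w a b : V} (hr : H.Reachable u w)
    (h : H.dist u w < (H.deleteEdges {s(a, b)}).dist u w) :
    IsLastEdge H u a b ∨ IsLastEdge H u b a := by
  obtain ⟨p, hp, hl⟩ := hr.exists_path_of_dist
  rcases p.exists_append_cons_of_mem_edges (mem_edges_of_dist_lt hl h) with
    ⟨hab, q, r, rfl⟩ | ⟨hab, q, r, rfl⟩
  · exact .inl (isLastEdge_of_dist_lt_aux hab q r hp hl h)
  · exact .inr (isLastEdge_of_dist_lt_aux hab q r hp hl (by rwa [Sym2.eq_swap]))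

/-- If deleting the edge `ab` inside `B` destroys all walks of length at most `k`
between `x` and `y`, then this is visible between two vertices of `B`. -/
theorem exists_dist_lt_of_lt_length [Finite V] {B : Set V} {a b x y : V}
    (ha : a ∈ B) (hb : b ∈ B) (hK : (H.deleteEdges {s(a, b)}).Reachable a b)
    {k : ℕ} (P : H.Walk x y) (hP : P.length ≤ k)
    (hk : ∀ q : (H.deleteEdges {s(a, b)}).Walk x y, k < q.length) :
    ∃ u ∈ B, ∃ w ∈ B, H.Reachable u w ∧
      H.dist u w < (H.deleteEdges {s(a, b)}).dist u w ∧
      k + 1 ≤ branchSize H B u + branchSize H B w + (H.deleteEdges {s(a, b)}).dist u w := by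
  classical
  obtain ⟨P, hpath, hP⟩ : ∃ Q : H.Walk x y, Q.IsPath ∧ Q.length ≤ k :=
    ⟨P.bypass, P.bypass_isPath, P.length_bypass_le_length.trans hP⟩
  have he : s(a, b) ∈ P.edges := by
    by_contra he
    obtain ⟨q, hq, -⟩ := P.exists_deleteEdges he
    have := hk q
    omega
  have haP : a ∈ P.support := P.fst_mem_support_of_mem_edges he
  -- The first vertex `u` of `P` in `B` exists because `P` visits `a`; reversing the remainder gives
  -- the last one, `w`. The end pieces `q` and `s` lie in branches and avoid `ab`.
  obtain ⟨u, huB, q, r, hqr, hq⟩ : ∃ u ∈ B, ∃ (q : H.Walk x u) (r : H.Walk u y),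
      P = q.append r ∧ ∀ z ∈ q.support, z ∈ B → z = u := by
    obtain ⟨u, hu, q, r, h1, h2⟩ := (P.takeUntil a haP).exists_first_mem ha
    exact ⟨u, hu, q, r.append (P.dropUntil a haP), by
      rw [Walk.append_assoc, ← h1, Walk.take_spec], h2⟩
  obtain ⟨w, hwB, s, t, hst, hs⟩ := r.reverse.exists_first_mem huB
  have hr : r = t.reverse.append s.reverse := by
    rw [← Walk.reverse_append, ← hst, Walk.reverse_reverse]
  subst hqr
  have hqp : q.IsPath := hpath.of_append_left
  have hsp : s.IsPath := by
    have h1 := hpath.of_append_right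
    rw [← Walk.isPath_reverse_iff, hst] at h1
    exact h1.of_append_left
  have hlq := hqp.length_le_branchSize hq
  have hls := hsp.length_le_branchSize hs
  have avoid : ∀ {c d : V} (q : H.Walk c d), (∀ z ∈ q.support, z ∈ B → z = d) →
      s(a, b) ∉ q.edges := fun q hq h => by
    have h1 := hq a (q.fst_mem_support_of_mem_edges h) ha
    have h2 := hq b (q.snd_mem_support_of_mem_edges h) hb
    exact (q.adj_of_mem_edges h).ne (h1.trans h2.symm)
  obtain ⟨q', hq', -⟩ := q.exists_deleteEdges (avoid q hq)
  obtain ⟨s', hs', -⟩ := s.exists_deleteEdges (avoid s hs)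
  have hR : H.Reachable u w := t.reverse.reachable
  obtain ⟨m, hm⟩ := (reachable_deleteEdges hK hR).exists_walk_length_eq_dist
  -- Replacing the middle of `P` by a geodesic `m` of the smaller graph gives a walk that must
  -- exceed `k`, whereas `P` does not: hence both inequalities.
  have h1 := hk ((q'.append m).append s'.reverse)
  have h2 := dist_le t.reverse
  simp only [Walk.length_append, Walk.length_reverse, hr] at h1 h2 hP
  exact ⟨u, huB, w, hwB, hR, by omega, by omega⟩

/-! ### Cycles as maps from `ZMod g` -/

section Cycle

variable {g : ℕ} {f : ZMod g → V}

/-- Two edges agreeing in reverse order would force `2 = 0` in `ZMod g`, which `3 ≤ g` excludes. -/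
theorem cycleEdge_injective (hg : 3 ≤ g) (hf : Function.Injective f) :
    Function.Injective fun i => s(f i, f (i + 1)) := by
  intro i j h
  simp only [Sym2.eq_iff] at h
  rcases h with ⟨h, -⟩ | ⟨h1, h2⟩
  · exact hf h
  · exfalso
    have h1 := hf h1
    have h2 := hf h2
    have : ((2 : ℕ) : ZMod g) = 0 := by
      have : j + 1 + 1 = j := by rw [← h1]; exact h2
      have : (1 + 1 : ZMod g) = 0 := by linear_combination this
      push_cast
      linear_combination this
    rw [ZMod.natCast_eq_zero_iff] at this
    exact absurd (Nat.le_of_dvd (by norm_num) this) (by omega)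

theorem exists_arc (hg : 3 ≤ g) (hf : Function.Injective f)
    (hadj : ∀ i, H.Adj (f i) (f (i + 1))) (i j : ZMod g) (m : ℕ)
    (h : ∀ l < m, j + (l : ZMod g) ≠ i) :
    ∃ p : (H.deleteEdges {s(f i, f (i + 1))}).Walk (f j) (f (j + m)),
      p.length = m ∧ ∀ x ∈ p.support, x ∈ Set.range f := by
  induction m with
  | zero =>
    rw [Nat.cast_zero, add_zero]
    exact ⟨.nil, rfl, by simp⟩
  | succ m ih =>
    obtain ⟨p, hp, hs⟩ := ih fun l hl => h l (by omega)
    have ha : (H.deleteEdges {s(f i, f (i + 1))}).Adj (f (j + m)) (f (j + (m + 1 : ℕ))) := by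
      rw [Nat.cast_succ, ← add_assoc, deleteEdges_adj]
      exact ⟨hadj _, fun h' => h m (by omega) (cycleEdge_injective hg hf h')⟩
    refine ⟨p.concat ha, by simp [hp], fun x hx => ?_⟩
    rw [Walk.support_concat, List.mem_append, List.mem_singleton] at hx
    rcases hx with hx | rfl
    · exact hs x hx
    · exact ⟨_, rfl⟩

theorem zmod_natCast_ne_zero_of_lt {g m : ℕ} (h0 : 0 < m) (h : m < g) : (m : ZMod g) ≠ 0 := by
  rw [Ne, ZMod.natCast_eq_zero_iff]
  exact fun h' => absurd (Nat.le_of_dvd h0 h') (by omega)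

theorem exists_walk_range (hg : 3 ≤ g) (hf : Function.Injective f)
    (hadj : ∀ i, H.Adj (f i) (f (i + 1))) (i j l : ZMod g) :
    ∃ p : (H.deleteEdges {s(f i, f (i + 1))}).Walk (f j) (f l),
      ∀ x ∈ p.support, x ∈ Set.range f := by
  have : NeZero g := ⟨by omega⟩
  have key : ∀ j, ∃ p : (H.deleteEdges {s(f i, f (i + 1))}).Walk (f (i + 1)) (f j),
      ∀ x ∈ p.support, x ∈ Set.range f := fun j => by
    have := exists_arc hg hf hadj i (i + 1) (j - (i + 1)).val fun l hl h => by
      have hlt := ZMod.val_lt (j - (i + 1))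
      refine zmod_natCast_ne_zero_of_lt (g := g) (m := l + 1) (by omega) (by omega) ?_
      push_cast
      linear_combination h
    rw [ZMod.natCast_zmod_val, add_sub_cancel] at this
    obtain ⟨p, -, hp⟩ := this
    exact ⟨p, hp⟩
  obtain ⟨p, hp⟩ := key j
  obtain ⟨q, hq⟩ := key l
  refine ⟨p.reverse.append q, fun x hx => ?_⟩
  rw [Walk.mem_support_append_iff, Walk.support_reverse, List.mem_reverse] at hx
  exact hx.elim (hp x) (hq x)

/-- The complementary arc, continuing forward from `i + 1 + t` to `i - s`, has `g - (s + t + 1)`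
edges and avoids edge `i`. -/
theorem dist_deleteEdges_le_arc (hg : 3 ≤ g) (hf : Function.Injective f)
    (hadj : ∀ i, H.Adj (f i) (f (i + 1))) (i : ZMod g) {s t : ℕ} (hst : s + t + 1 ≤ g) :
    (H.deleteEdges {s(f i, f (i + 1))}).dist (f (i - s)) (f (i + 1 + t)) + (s + t + 1) ≤ g := by
  obtain ⟨p, hp, -⟩ := exists_arc hg hf hadj i (i + 1 + t) (g - (s + t + 1)) fun l hl h => by
    refine zmod_natCast_ne_zero_of_lt (g := g) (m := l + t + 1) (by omega) (by omega) ?_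
    push_cast
    linear_combination h
  have h1 := hp ▸ dist_le p
  have h2 : i + 1 + (t : ZMod g) + ((g - (s + t + 1) : ℕ) : ZMod g) = i - s := by
    have : ((g - (s + t + 1) + (s + t + 1) : ℕ) : ZMod g) = 0 := by
      rw [Nat.sub_add_cancel hst, ZMod.natCast_self]
    push_cast at this
    linear_combination this
  rw [h2, dist_comm] at h1
  omega

/-- No vertex is an end of pairs that are separated further by each of the edges of the cycle. -/
theorem exists_edge_not_dist_lt (hg : 3 ≤ g) (hf : Function.Injective f)
    (hadj : ∀ i, H.Adj (f i) (f (i + 1))) (u : V) :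
    ∃ i, ∀ w, H.Reachable u w →
      ¬ H.dist u w < (H.deleteEdges {s(f i, f (i + 1))}).dist u w := by
  have : NeZero g := ⟨by omega⟩
  -- At a cycle vertex `f m` farthest from `u`, the edge before it must be the only last edge of
  -- geodesics into `f m`. The edge after it could then only lead to a vertex still farther away.
  obtain ⟨m, hm⟩ := Finite.exists_max fun i => H.dist u (f i)
  by_contra! hcon
  obtain ⟨w, hw, hlt⟩ := hcon m
  obtain ⟨w', hw', hlt'⟩ := hcon (m - 1)
  rw [sub_add_cancel] at hlt'
  have hne : f (m + 1) ≠ f (m - 1) := fun h => by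
    have h := hf h
    refine zmod_natCast_ne_zero_of_lt (g := g) (m := 2) (by omega) (by omega) ?_
    push_cast
    linear_combination h
  have h1 := hm (m + 1)
  have h2 := hm (m - 1)
  rcases isLastEdge_of_dist_lt hw' hlt' with h | h
  · have h3 := h.2 _ (hadj m).symm hne
    rcases isLastEdge_of_dist_lt hw hlt with h' | h'
    · have := h'.1; omega
    · have := h'.1; omega
  · have := h.1; omega

end Cycle

end SimpleGraph

namespace SimpleGraph

variable {V : Type*} {H : SimpleGraph V}

/-! ### Distances inside the hull of a cycle -/

theorem Adj.dist_le_dist_add_one {u x y : V} (h : H.Adj x y) (hx : H.Reachable u x) :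
    H.dist u y ≤ H.dist u x + 1 := by
  obtain ⟨p, hp⟩ := hx.exists_walk_length_eq_dist
  simpa [hp] using dist_le (p.concat h)

theorem PathClosed.mem_of_isPath_of_le {K : SimpleGraph V} {B : Set V} (hB : PathClosed H B)
    (hK : K ≤ H) {u w : V} (hu : u ∈ B) (hw : w ∈ B) {p : K.Walk u w} (hp : p.IsPath) {x : V}
    (hx : x ∈ p.support) : x ∈ B :=
  hB u hu w hw (p.mapLe hK) (hp.mapLe hK) x (by rwa [Walk.support_mapLe_eq_support])

/-- The graph of all edges with both ends in `B`. -/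
def inside (G : SimpleGraph V) (B : Set V) : SimpleGraph V where
  Adj x y := G.Adj x y ∧ x ∈ B ∧ y ∈ B
  symm := ⟨fun _ _ h => ⟨h.1.symm, h.2.2, h.2.1⟩⟩
  loopless := ⟨fun x h => G.loopless.irrefl x h.1⟩

theorem inside_le (B : Set V) : inside H B ≤ H := fun _ _ h => h.1

theorem Walk.support_subset_of_inside {B : Set V} {x y : V} (p : (inside H B).Walk x y)
    (hp : ¬ p.Nil) : ∀ v ∈ p.support, v ∈ B := by
  intro v hv
  obtain ⟨e, he, hve⟩ := (Walk.mem_support_iff_exists_mem_edges_of_not_nil hp).1 hv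
  induction e with | _ a b =>
  have := p.adj_of_mem_edges he
  rcases Sym2.mem_iff.1 hve with rfl | rfl
  · exact this.2.1
  · exact this.2.2

/-- The two vertices cut the closed walk into two walks between them. -/
theorem Walk.two_mul_dist_le_length {v x y : V} (c : H.Walk v v) (hx : x ∈ c.support)
    (hy : y ∈ c.support) : 2 * H.dist x y ≤ c.length := by
  classical
  have hy' : y ∈ (c.rotate x hx).support := by
    rwa [Walk.mem_support_rotate_iff]
  have h := congrArg Walk.length ((c.rotate x hx).take_spec hy')
  have h1 := dist_le ((c.rotate x hx).takeUntil y hy')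
  have h2 := dist_le ((c.rotate x hx).dropUntil y hy')
  rw [dist_comm] at h2
  simp only [Walk.length_append, Walk.length_rotate] at h
  omega

/-- A geodesic of length `d` and a cycle of length `m` cover at least `d + m / 2` vertices. -/
theorem Walk.IsCycle.dist_add_length_le {K : SimpleGraph V} {B : Finset V} {v u w : V}
    {c : K.Walk v v} (hc : c.IsCycle) (hcB : ∀ x ∈ c.support, x ∈ B) {q : K.Walk u w}
    (hq : q.length = K.dist u w) (hqB : ∀ x ∈ q.support, x ∈ B) :
    2 * K.dist u w + c.length ≤ 2 * B.card := by
  classical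
  have hqn := (q.isPath_of_length_eq_dist hq).support_nodup
  set Q := q.support.toFinset with hQ
  set C := c.support.tail.toFinset with hC
  have hQc : Q.card = K.dist u w + 1 := by
    rw [hQ, List.toFinset_card_of_nodup hqn, Walk.length_support, hq]
  have hCc : C.card = c.length := by
    rw [hC, List.toFinset_card_of_nodup hc.support_nodup, List.length_tail, Walk.length_support,
      Nat.add_sub_cancel]
  have hCs : ∀ x ∈ C, x ∈ c.support := fun x hx => List.mem_of_mem_tail (List.mem_toFinset.1 hx)
  have hU : (Q ∪ C).card ≤ B.card := Finset.card_le_card <| Finset.union_subset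
    (fun x hx => hqB x (List.mem_toFinset.1 hx)) fun x hx => hcB x (hCs x hx)
  have hUI := Finset.card_union_add_card_inter Q C
  -- Common vertices have distinct distances from `u`, being on a geodesic, and these differ by at
  -- most half the cycle length, being on the cycle.
  have hI : (Q ∩ C).card ≤ c.length / 2 + 1 := by
    have hdist : ∀ x (hx : x ∈ q.support), (q.takeUntil x hx).length = K.dist u x := fun x hx =>
      length_eq_dist_of_subwalk hq (q.isSubwalk_takeUntil hx)
    have hinj : Set.InjOn (K.dist u) (Q ∩ C : Finset V) := by
      intro x hx y hy hxy
      have hx := List.mem_toFinset.1 (Finset.mem_inter.1 hx).1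
      have hy := List.mem_toFinset.1 (Finset.mem_inter.1 hy).1
      have h1 := Walk.getVert_length_takeUntil hx
      have h2 := Walk.getVert_length_takeUntil hy
      rw [hdist] at h1 h2
      rw [← h1, ← h2, hxy]
    rw [← Finset.card_image_of_injOn hinj]
    rcases (Q ∩ C).eq_empty_or_nonempty with h0 | h0
    · simp [h0]
    obtain ⟨x, hx, hmin⟩ := Finset.exists_min_image (Q ∩ C) (K.dist u) h0
    have hsub : (Q ∩ C).image (K.dist u) ⊆
        Finset.Icc (K.dist u x) (K.dist u x + c.length / 2) := by
      intro t ht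
      obtain ⟨y, hy, rfl⟩ := Finset.mem_image.1 ht
      have h1 := c.two_mul_dist_le_length (hCs x (Finset.mem_inter.1 hx).2)
        (hCs y (Finset.mem_inter.1 hy).2)
      have h2 := ((q.takeUntil x (List.mem_toFinset.1
        (Finset.mem_inter.1 hx).1)).reachable).dist_triangle_left y
      have h3 := hmin y hy
      rw [Finset.mem_Icc]
      omega
    refine (Finset.card_le_card hsub).trans ?_
    rw [Nat.card_Icc]
    omega
  omega

section Cycle

variable {g : ℕ} {f : ZMod g → V}

/-- If all vertices of the hull at distance `t` from `u` coincide, then that vertex lies on the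
cycle. -/
theorem mem_range_of_unique_layer (hg : 3 ≤ g) (hf : Function.Injective f)
    (hadj : ∀ i, H.Adj (f i) (f (i + 1))) (i : ZMod g) {u w z : V}
    (hu : u ∈ pathHull H (Set.range f)) (hw : w ∈ pathHull H (Set.range f))
    (hr : ∀ x ∈ pathHull H (Set.range f),
      (H.deleteEdges {s(f i, f (i + 1))}).Reachable u x) {t : ℕ} (h0 : 0 < t)
    (ht : t < (H.deleteEdges {s(f i, f (i + 1))}).dist u w)
    (hz : ∀ x ∈ pathHull H (Set.range f),
      (H.deleteEdges {s(f i, f (i + 1))}).dist u x = t → x = z) : z ∈ Set.range f := by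
  by_contra hzC
  set B := pathHull H (Set.range f)
  set K := H.deleteEdges {s(f i, f (i + 1))} with hK
  have hCB : Set.range f ⊆ B := subset_pathHull _
  -- The cycle stays connected without edge `i`, so if it had vertices on both sides of layer `t` it
  -- would meet the layer, that is, contain `z`.
  have hside : (∀ x ∈ Set.range f, t < K.dist u x) ∨ (∀ x ∈ Set.range f, K.dist u x < t) := by
    by_contra! hcon
    obtain ⟨⟨_, ⟨j, rfl⟩, hj⟩, ⟨_, ⟨l, rfl⟩, hl⟩⟩ := hcon
    obtain ⟨p, hp⟩ := exists_walk_range hg hf hadj i j l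
    have hjt : K.dist u (f j) < t := lt_of_le_of_ne hj fun h =>
      hzC (hz _ (hCB ⟨j, rfl⟩) h ▸ ⟨j, rfl⟩)
    obtain ⟨d, hd, h1, h2⟩ := p.exists_boundary_dart {x | K.dist u x < t} hjt (by simpa using hl)
    have h3 := hp _ (p.dart_fst_mem_support_of_mem_darts hd)
    have h4 := hp _ (p.dart_snd_mem_support_of_mem_darts hd)
    have h5 : K.dist u d.snd ≤ K.dist u d.fst + 1 := d.adj.dist_le_dist_add_one (hr _ (hCB h3))
    simp only [Set.mem_ofPred_eq, not_lt] at h1 h2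
    exact hzC (hz _ (hCB h4) (by omega) ▸ h4)
  have hadjK : ∀ {x y}, H.Adj x y → y ∉ Set.range f → K.Adj x y := fun {x y} hxy hy => by
    rw [hK, deleteEdges_adj]
    refine ⟨hxy, fun h => hy ?_⟩
    rcases Sym2.eq_iff.1 h with ⟨-, h⟩ | ⟨-, h⟩
    · exact ⟨_, h.symm⟩
    · exact ⟨_, h.symm⟩
  rcases hside with hside | hside
  -- The side containing the cycle can be left only through `z`, so it is the whole hull; but `u`
  -- lies on the other side here, and `w` does in the second case.
  · have := pathHull_subset_of_separator (G := H) (A := {x | x ∈ B ∧ t ≤ K.dist u x})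
      (fun x hx => hx.1) (fun x hx => ⟨hCB hx, (hside x hx).le⟩) z (fun x hx y hy hyA hxy => by
        have hyt : K.dist u y < t := not_le.1 fun h => hyA ⟨hy, h⟩
        have h1 := hadjK hxy fun hyC => by have := hside y hyC; omega
        have h2 := h1.symm.dist_le_dist_add_one (hr y hy)
        exact hz x hx.1 (le_antisymm (by omega) hx.2)) hu
    have := this.2
    simp at this
    omega
  · have := pathHull_subset_of_separator (G := H) (A := {x | x ∈ B ∧ K.dist u x ≤ t})
      (fun x hx => hx.1) (fun x hx => ⟨hCB hx, (hside x hx).le⟩) z (fun x hx y hy hyA hxy => by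
        have hyt : t < K.dist u y := not_le.1 fun h => hyA ⟨hy, h⟩
        have h1 := hadjK hxy fun hyC => by have := hside y hyC; omega
        have h2 := h1.dist_le_dist_add_one (hr x hx.1)
        exact hz x hx.1 (le_antisymm hx.2 (by omega))) hw
    have := this.2
    omega

theorem exists_mem_dist_eq {K : SimpleGraph V} {B : Set V} (hB : PathClosed H B) (hKH : K ≤ H)
    {u w : V} (hu : u ∈ B) (hw : w ∈ B) (hr : K.Reachable u w) {t : ℕ} (ht : t ≤ K.dist u w) :
    ∃ x ∈ B, K.dist u x = t := by
  obtain ⟨q, hqp, hq⟩ := hr.exists_path_of_dist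
  refine ⟨q.getVert t, hB.mem_of_isPath_of_le hKH hu hw hqp (q.getVert_mem_support t), ?_⟩
  have h1 := dist_le (q.take t)
  have h2 := dist_le (q.drop t)
  have h3 := (q.take t).reachable.dist_triangle_left w
  rw [Walk.take_length] at h1
  rw [Walk.drop_length] at h2
  omega

/-- Let `D` be the distance. Each layer `0 < t < D` around `u` has two vertices in the hull, or a
single one, which then lies on the cycle and is counted again there. As `u` and `w` are in none of
these layers, `2 * (D - 1) ≤ (|B| - 2) + g`. -/
theorem two_mul_dist_le_card_add [Fintype V] (hg : 3 ≤ g) (hf : Function.Injective f)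
    (hadj : ∀ i, H.Adj (f i) (f (i + 1))) {B : Finset V}
    (hB : (B : Set V) = pathHull H (Set.range f)) (i : ZMod g) {u w : V}
    (hu : u ∈ B) (hw : w ∈ B)
    (hr : ∀ x ∈ B, (H.deleteEdges {s(f i, f (i + 1))}).Reachable u x) :
    2 * (H.deleteEdges {s(f i, f (i + 1))}).dist u w ≤ B.card + g := by
  classical
  have : NeZero g := ⟨by omega⟩
  set K := H.deleteEdges {s(f i, f (i + 1))} with hK
  rcases Nat.eq_zero_or_pos (K.dist u w) with h0 | h0
  · omega
  have hmem : ∀ x, x ∈ pathHull H (Set.range f) ↔ x ∈ B := fun x => by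
    rw [← hB, Finset.mem_coe]
  have huw : u ≠ w := by rintro rfl; simp at h0
  set C := Finset.univ.image f with hC
  set B' := (B.erase u).erase w with hB'
  have hB'c : B'.card + 2 = B.card := by
    have h1 := Finset.card_erase_add_one hu
    have h2 := Finset.card_erase_add_one (Finset.mem_erase.2 ⟨huw.symm, hw⟩)
    rw [← hB'] at h2
    omega
  have hCc : C.card = g := by
    rw [hC, Finset.card_image_of_injective _ hf, Finset.card_univ, ZMod.card]
  have key : ∀ t ∈ Finset.Ioo 0 (K.dist u w), 2 ≤
      (B'.filter fun x => K.dist u x = t).card + (C.filter fun x => K.dist u x = t).card := by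
    intro t ht
    rw [Finset.mem_Ioo] at ht
    have hfil : (B'.filter fun x => K.dist u x = t) = B.filter fun x => K.dist u x = t := by
      ext x
      simp only [hB', Finset.mem_filter, Finset.mem_erase]
      constructor
      · exact fun h => ⟨h.1.2.2, h.2⟩
      · rintro ⟨h1, h2⟩
        refine ⟨⟨?_, ?_, h1⟩, h2⟩
        · rintro rfl; omega
        · rintro rfl; simp at h2; omega
    rw [hfil]
    obtain ⟨x, hx, hxt⟩ := exists_mem_dist_eq (pathClosed_pathHull (G := H) (Set.range f))
      (deleteEdges_le _ : K ≤ H) ((hmem u).2 hu) ((hmem w).2 hw) (hr w hw) ht.2.le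
    have hxF : x ∈ B.filter fun x => K.dist u x = t :=
      Finset.mem_filter.2 ⟨(hmem x).1 hx, hxt⟩
    have h1 : 0 < (B.filter fun x => K.dist u x = t).card := Finset.card_pos.2 ⟨x, hxF⟩
    by_cases h2 : (B.filter fun x => K.dist u x = t).card = 1
    · have hone := Finset.card_le_one.1 h2.le
      have := mem_range_of_unique_layer hg hf hadj i ((hmem u).2 hu) ((hmem w).2 hw)
        (fun y hy => hr y ((hmem y).1 hy)) ht.1 ht.2 (z := x) fun y hy hyt =>
          hone y (Finset.mem_filter.2 ⟨(hmem y).1 hy, hyt⟩) x hxF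
      obtain ⟨j, rfl⟩ := this
      have : 0 < (C.filter fun x => K.dist u x = t).card := Finset.card_pos.2
        ⟨f j, Finset.mem_filter.2 ⟨Finset.mem_image_of_mem f (Finset.mem_univ j), hxt⟩⟩
      omega
    · omega
  have hsum := Finset.sum_le_sum key
  rw [Finset.sum_add_distrib, Finset.sum_card_fiberwise_eq_card_filter,
    Finset.sum_card_fiberwise_eq_card_filter, Finset.sum_const, Nat.card_Ioo, smul_eq_mul] at hsum
  have h1 := Finset.card_filter_le B' fun x => K.dist u x ∈ Finset.Ioo 0 (K.dist u w)
  have h2 := Finset.card_filter_le C fun x => K.dist u x ∈ Finset.Ioo 0 (K.dist u w)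
  omega

/-- A cycle one of whose edges lies on every cycle of its hull is path-closed. -/
theorem pathClosed_range_of_isAcyclic (hg : 3 ≤ g) (hf : Function.Injective f)
    (hadj : ∀ i, H.Adj (f i) (f (i + 1))) (i : ZMod g)
    (hac : (inside (H.deleteEdges {s(f i, f (i + 1))}) (pathHull H (Set.range f))).IsAcyclic) :
    PathClosed H (Set.range f) := by
  classical
  set B := pathHull H (Set.range f)
  set K := H.deleteEdges {s(f i, f (i + 1))} with hK
  have hCB : Set.range f ⊆ B := subset_pathHull _
  intro c hc c' hc' p hp v hv
  by_contra hvC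
  have hpB := pathClosed_pathHull (G := H) (Set.range f) c (hCB hc) c' (hCB hc') p hp
  obtain ⟨q, r, rfl⟩ := Walk.mem_support_iff_exists_append.1 hv
  obtain ⟨c₂, hc₂, s₂, r₂, hr₂, hs₂⟩ := r.exists_first_mem hc'
  obtain ⟨c₁, hc₁, s₁, r₁, hr₁, hs₁⟩ := q.reverse.exists_first_mem hc
  have hs₁q : ∀ x ∈ s₁.support, x ∈ q.support := fun x hx => by
    rw [← List.mem_reverse, ← Walk.support_reverse, hr₁]
    exact Walk.support_subset_support_append_left _ _ hx
  have hs₂r : ∀ x ∈ s₂.support, x ∈ r.support := fun x hx => by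
    rw [hr₂]
    exact Walk.support_subset_support_append_left _ _ hx
  -- A path leaving the cycle at `v` reaches it on both sides of `v`, in different vertices since it
  -- is a path.
  have hne : c₁ ≠ c₂ := by
    rintro rfl
    exact hvC (hp.disjoint_of_append (hs₁q _ s₁.end_mem_support)
      (hs₂r _ s₂.end_mem_support) ▸ hc₁)
  have htrans : ∀ {d : V} (s : H.Walk v d), (∀ z ∈ s.support, z ∈ Set.range f → z = d) →
      (∀ z ∈ s.support, z ∈ B) → (outside (inside K B) (Set.range f)).Reachable v d := by
    intro d s hs hsB
    obtain ⟨s', -⟩ := s.transfer_of_forall (K := outside (inside K B) (Set.range f))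
      fun a b hab => by
        have ha := s.fst_mem_support_of_mem_edges hab
        have hb := s.snd_mem_support_of_mem_edges hab
        have hab' := s.adj_of_mem_edges hab
        have hnot : ¬ (a ∈ Set.range f ∧ b ∈ Set.range f) := fun h =>
          hab'.ne ((hs a ha h.1).trans (hs b hb h.2).symm)
        refine ⟨⟨?_, hsB a ha, hsB b hb⟩, hnot⟩
        rw [hK, deleteEdges_adj]
        refine ⟨hab', fun h => hnot ?_⟩
        rcases Sym2.eq_iff.1 h with ⟨rfl, rfl⟩ | ⟨rfl, rfl⟩
        · exact ⟨⟨_, rfl⟩, ⟨_, rfl⟩⟩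
        · exact ⟨⟨_, rfl⟩, ⟨_, rfl⟩⟩
    exact s'.reachable
  have h1 := htrans s₁ hs₁ fun z hz => hpB z (by
    rw [Walk.mem_support_append_iff]; exact .inl (hs₁q z hz))
  have h2 := htrans s₂ hs₂ fun z hz => hpB z (by
    rw [Walk.mem_support_append_iff]; exact .inr (hs₂r z hz))
  obtain ⟨m, hm⟩ := (h1.symm.trans h2).exists_isPath
  obtain ⟨j, rfl⟩ := hc₁
  obtain ⟨l, rfl⟩ := hc₂
  obtain ⟨a, ha⟩ := exists_walk_range hg hf hadj i j l
  obtain ⟨a', -, ha', -⟩ := a.transfer_of_forall (K := inside K B) fun x y hxy =>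
    ⟨a.adj_of_mem_edges hxy, hCB (ha x (a.fst_mem_support_of_mem_edges hxy)),
      hCB (ha y (a.snd_mem_support_of_mem_edges hxy))⟩
  -- Two paths from `c₁` to `c₂`: one without edges inside the range of `f`, one along the cycle.
  -- Uniqueness of paths in a forest would identify them.
  have huniq := (hac.subsingleton_path _ _).elim ⟨m.mapLe (outside_le _), hm.mapLe _⟩
    ⟨a'.bypass, a'.bypass_isPath⟩
  have hsup := congrArg Walk.support (congrArg Subtype.val huniq)
  simp only [Walk.support_mapLe_eq_support] at hsup
  obtain ⟨x, hx, m', rfl⟩ := Walk.exists_eq_cons_of_ne hne m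
  refine hx.2 ⟨⟨j, rfl⟩, ha x ?_⟩
  rw [← ha']
  refine a'.support_bypass_subset_support ?_
  rw [← hsup]
  simp

/-- If the hull of a shortest cycle has further vertices, then distances after deleting an edge of
the cycle are at most three quarters of the size of the hull. -/
theorem four_mul_dist_le [Fintype V] (hg : 3 ≤ g) (hf : Function.Injective f)
    (hadj : ∀ i, H.Adj (f i) (f (i + 1)))
    (hmin : ∀ (v : V) (c : H.Walk v v), c.IsCycle → g ≤ c.length) {B : Finset V}
    (hB : (B : Set V) = pathHull H (Set.range f)) (hne : ¬ PathClosed H (Set.range f))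
    (i : ZMod g) {u w : V} (hu : u ∈ B) (hw : w ∈ B)
    (hr : ∀ x ∈ B, (H.deleteEdges {s(f i, f (i + 1))}).Reachable u x) :
    4 * (H.deleteEdges {s(f i, f (i + 1))}).dist u w ≤ 3 * B.card := by
  have h1 := two_mul_dist_le_card_add hg hf hadj hB i hu hw hr
  have hac := mt (pathClosed_range_of_isAcyclic hg hf hadj i) hne
  rw [← hB] at hac
  simp only [IsAcyclic, not_forall, not_not] at hac
  obtain ⟨v, c, hc⟩ := hac
  obtain ⟨q, hqp, hq⟩ := (hr w hw).exists_path_of_dist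
  have hBc : PathClosed H (B : Set V) := hB ▸ pathClosed_pathHull _
  have h2 := Walk.IsCycle.dist_add_length_le (hc.mapLe (inside_le _)) (B := B) (fun x hx => by
    rw [Walk.support_mapLe_eq_support] at hx
    exact c.support_subset_of_inside hc.not_nil x hx) hq fun x hx =>
      hBc.mem_of_isPath_of_le (deleteEdges_le _) hu hw hqp hx
  -- The second cycle has length at least `g`, so `h2` gives `2 * D + g ≤ 2 * |B|`, to be added to
  -- `h1`.
  have h3 := hmin v _ ((hc.mapLe (inside_le _)).mapLe (deleteEdges_le _))
  simp only [Walk.length_mapLe] at h2 h3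
  omega

end Cycle

end SimpleGraph

/-! ### Counting along a cycle of pairs -/

/-- Suppose any two pairs meet. A pair avoiding `u i` has the form `{w i, z}`; a pair avoiding `w i`
must meet both of these, so it is `{u i, z}`. Any further pair meeting all three sides is one of
them. -/
theorem Finset.disjoint_pairs_or_triangle {ι V : Type*} [Nonempty ι] {u w : ι → V}
    (huw : ∀ i, u i ≠ w i) (hstar : ∀ v, ∃ i, u i ≠ v ∧ w i ≠ v) :
    (∃ i j, u i ≠ u j ∧ u i ≠ w j ∧ w i ≠ u j ∧ w i ≠ w j) ∨
    ∃ x y z, x ≠ y ∧ y ≠ z ∧ x ≠ z ∧ (∃ i, s(u i, w i) = s(x, y)) ∧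
      (∃ i, s(u i, w i) = s(y, z)) ∧ (∃ i, s(u i, w i) = s(x, z)) ∧
      ∀ i, s(u i, w i) = s(x, y) ∨ s(u i, w i) = s(y, z) ∨ s(u i, w i) = s(x, z) := by
  by_cases hd : ∃ i j, u i ≠ u j ∧ u i ≠ w j ∧ w i ≠ u j ∧ w i ≠ w j
  · exact .inl hd
  right
  have hint : ∀ i j, u i = u j ∨ u i = w j ∨ w i = u j ∨ w i = w j := by
    intro i j
    by_contra! h
    exact hd ⟨i, j, h⟩
  obtain ⟨i⟩ := ‹Nonempty ι›
  obtain ⟨j, hj1, hj2⟩ := hstar (u i)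
  obtain ⟨l, hl1, hl2⟩ := hstar (w i)
  obtain ⟨z, hz, hzj⟩ : ∃ z, z ≠ u i ∧ s(u j, w j) = s(w i, z) := by
    rcases hint i j with h | h | h | h
    · exact absurd h.symm hj1
    · exact absurd h.symm hj2
    · exact ⟨w j, hj2, by rw [h]⟩
    · exact ⟨u j, hj1, by rw [h, Sym2.eq_swap]⟩
  have hzw : w i ≠ z := by
    rintro rfl
    have := huw j
    rw [Sym2.eq_iff] at hzj
    rcases hzj with ⟨h1, h2⟩ | ⟨h1, h2⟩ <;> exact this (h1.trans h2.symm)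
  have hl : s(u l, w l) = s(u i, z) := by
    have h1 := hint i l
    have h2 := hint j l
    rw [Sym2.eq_iff] at hzj ⊢
    grind
  refine ⟨u i, w i, z, huw i, hzw, hz.symm, ⟨i, rfl⟩, ⟨j, hzj⟩, ⟨l, hl⟩, fun m => ?_⟩
  have h1 := hint i m
  have h2 := hint j m
  have h3 := hint l m
  have h4 := huw m
  rw [Sym2.eq_iff] at hzj hl
  rw [Sym2.eq_iff, Sym2.eq_iff, Sym2.eq_iff]
  grind

theorem Finset.add_four_le_sum {V : Type*} {B : Finset V} (h : V → ℕ) {a b c d : V}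
    (ha : a ∈ B) (hb : b ∈ B) (hc : c ∈ B) (hd : d ∈ B) (hab : a ≠ b) (hac : a ≠ c)
    (had : a ≠ d) (hbc : b ≠ c) (hbd : b ≠ d) (hcd : c ≠ d) :
    h a + h b + h c + h d ≤ ∑ v ∈ B, h v := by
  classical
  have hsub : ({a, b, c, d} : Finset V) ⊆ B := by
    intro x hx
    simp only [Finset.mem_insert, Finset.mem_singleton] at hx
    rcases hx with rfl | rfl | rfl | rfl <;> assumption
  refine le_trans (le_of_eq ?_) (Finset.sum_le_sum_of_subset hsub)
  rw [Finset.sum_insert (by simp [*]), Finset.sum_insert (by simp [*]),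
    Finset.sum_insert (by simp [*]), Finset.sum_singleton]
  ring

theorem Finset.add_three_le_sum {V : Type*} {B : Finset V} (h : V → ℕ) {a b c : V}
    (ha : a ∈ B) (hb : b ∈ B) (hc : c ∈ B) (hab : a ≠ b) (hac : a ≠ c) (hbc : b ≠ c) :
    h a + h b + h c ≤ ∑ v ∈ B, h v := by
  classical
  have hsub : ({a, b, c} : Finset V) ⊆ B := by
    intro x hx
    simp only [Finset.mem_insert, Finset.mem_singleton] at hx
    rcases hx with rfl | rfl | rfl <;> assumption
  refine le_trans (le_of_eq ?_) (Finset.sum_le_sum_of_subset hsub)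
  rw [Finset.sum_insert (by simp [*]), Finset.sum_insert (by simp [*]), Finset.sum_singleton]
  ring

/-- Truncation loses nothing at `a` and `b`, where the full `m` is subtracted. -/
theorem Finset.sum_tsub_add_two_mul_le {V : Type*} {B : Finset V} (h : V → ℕ) {a b : V} {m : ℕ}
    (ha : a ∈ B) (hb : b ∈ B) (hab : a ≠ b) (hma : m ≤ h a) (hmb : m ≤ h b) :
    ∑ v ∈ B, (h v - m) + 2 * m ≤ ∑ v ∈ B, h v := by
  classical
  have hb' : b ∈ B.erase a := Finset.mem_erase.2 ⟨hab.symm, hb⟩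
  rw [← Finset.add_sum_erase _ _ ha, ← Finset.add_sum_erase _ h ha, ← Finset.add_sum_erase _ _ hb',
    ← Finset.add_sum_erase _ h hb']
  have : ∑ v ∈ (B.erase a).erase b, (h v - m) ≤ ∑ v ∈ (B.erase a).erase b, h v :=
    Finset.sum_le_sum fun v _ => Nat.sub_le _ _
  omega

/-- If every edge of a cycle lies within distance `h j` of some vertex `j`, then the numbers `h j`
add up to at least half the length of the cycle. -/
theorem ZMod.le_two_mul_sum {g : ℕ} [NeZero g] (h : ZMod g → ℕ)
    (hc : ∀ i : ZMod g, ∃ s t : ℕ, s + t + 1 ≤ h (i - s) + h (i + 1 + t)) :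
    g ≤ 2 * ∑ j, h j := by
  classical
  -- Each position `j` covers the `h j` edges after it and the `h j` edges before it. An arc through
  -- edge `i` shorter than the two reaches combined is covered at `i` from one of its ends.
  have hsub : (Finset.univ : Finset (ZMod g)) ⊆ Finset.univ.biUnion fun j : ZMod g =>
      (Finset.range (h j)).image (fun s : ℕ => j + (s : ZMod g)) ∪
        (Finset.range (h j)).image fun s : ℕ => j - 1 - (s : ZMod g) := by
    intro i _
    obtain ⟨s, t, hst⟩ := hc i
    rw [Finset.mem_biUnion]
    by_cases hs : s < h (i - s)
    · refine ⟨i - s, Finset.mem_univ _, Finset.mem_union_left _ ?_⟩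
      exact Finset.mem_image.2 ⟨s, Finset.mem_range.2 hs, by ring⟩
    · refine ⟨i + 1 + t, Finset.mem_univ _, Finset.mem_union_right _ ?_⟩
      exact Finset.mem_image.2 ⟨t, Finset.mem_range.2 (by omega), by ring⟩
  have h1 := Finset.card_le_card hsub
  rw [Finset.card_univ, ZMod.card] at h1
  refine h1.trans (Finset.card_biUnion_le.trans ?_)
  rw [Finset.mul_sum]
  refine Finset.sum_le_sum fun j _ => (Finset.card_union_le _ _).trans ?_
  have h2 := Finset.card_image_le (s := Finset.range (h j)) (f := fun s : ℕ => j + (s : ZMod g))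
  have h3 := Finset.card_image_le (s := Finset.range (h j))
    (f := fun s : ℕ => j - 1 - (s : ZMod g))
  rw [Finset.card_range] at h2 h3
  omega

/-- The left side is a multiple of `g` strictly between `0` and `2 * g`. -/
theorem ZMod.val_add_val_neg_sub_one {g : ℕ} [NeZero g] (x : ZMod g) :
    x.val + (-x - 1).val + 1 = g := by
  have h1 := ZMod.val_lt x
  have h2 := ZMod.val_lt (-x - 1)
  have h3 : ((x.val + (-x - 1).val + 1 : ℕ) : ZMod g) = 0 := by
    push_cast
    rw [ZMod.natCast_zmod_val, ZMod.natCast_zmod_val]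
    ring
  rw [ZMod.natCast_eq_zero_iff] at h3
  obtain ⟨c, hc⟩ := h3
  have : c = 1 := by
    rcases c with _ | _ | c
    · omega
    · rfl
    · have : g * 2 ≤ g * (c + 1 + 1) := Nat.mul_le_mul_left g (by omega)
      omega
  rw [this] at hc
  omega

/-- Any two positions on a cycle are the ends of an arc containing a given edge, in one of the two
orders. -/
theorem ZMod.exists_arc_through {g : ℕ} [NeZero g] (i a c : ZMod g) :
    ∃ s t : ℕ, s + t + 1 ≤ g ∧
      (i - s = a ∧ i + 1 + t = c ∨ i - s = c ∧ i + 1 + t = a) := by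
  by_cases h : (i - a).val + (c - i - 1).val + 1 ≤ g
  · refine ⟨_, _, h, .inl ⟨?_, ?_⟩⟩
    · rw [ZMod.natCast_zmod_val]; ring
    · rw [ZMod.natCast_zmod_val]; ring
  · refine ⟨(i - c).val, (a - i - 1).val, ?_, .inr ⟨?_, ?_⟩⟩
    -- The arc lengths for the two orders add up to `2 * g`, so one of them is at most `g`.
    · have h1 := ZMod.val_add_val_neg_sub_one (i - a)
      have h2 := ZMod.val_add_val_neg_sub_one (i - c)
      rw [neg_sub] at h1 h2
      omega
    · rw [ZMod.natCast_zmod_val]; ring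
    · rw [ZMod.natCast_zmod_val]; ring

/-! ### Contradictions from the pairs belonging to the edges of a short cycle -/

namespace SimpleGraph

variable {V : Type*} {H : SimpleGraph V}

section Cycle

variable {g : ℕ} {f : ZMod g → V}

theorem dist_le_arc (hadj : ∀ i, H.Adj (f i) (f (i + 1))) (j : ZMod g) (m : ℕ) :
    H.dist (f j) (f (j + m)) ≤ m := by
  suffices h : ∃ p : H.Walk (f j) (f (j + m)), p.length = m by
    obtain ⟨p, hp⟩ := h
    exact (dist_le p).trans hp.le
  induction m with
  | zero =>
    rw [Nat.cast_zero, add_zero]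
    exact ⟨.nil, rfl⟩
  | succ m ih =>
    obtain ⟨p, hp⟩ := ih
    have := hadj (j + m)
    rw [add_assoc] at this
    rw [Nat.cast_succ]
    exact ⟨p.concat this, by simp [hp]⟩

/-- The edges of the cycle that separate a fixed pair further lie on every geodesic. -/
theorem card_filter_pair_le (hg : 3 ≤ g) [NeZero g] [DecidableEq (Sym2 V)]
    (hf : Function.Injective f) {u w : ZMod g → V}
    (hlt : ∀ i, H.dist (u i) (w i) < (H.deleteEdges {s(f i, f (i + 1))}).dist (u i) (w i))
    {x y : V} (hr : H.Reachable x y) :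
    (Finset.univ.filter fun i => s(u i, w i) = s(x, y)).card ≤ H.dist x y := by
  obtain ⟨p, hp⟩ := hr.exists_walk_length_eq_dist
  rw [← hp, ← Walk.length_edges]
  refine le_trans ?_ (List.toFinset_card_le _)
  refine Finset.card_le_card_of_injOn (fun i => s(f i, f (i + 1))) (fun i hi => ?_)
    (cycleEdge_injective hg hf).injOn
  rw [Finset.coe_filter] at hi
  have hi := hi.2
  rw [Finset.mem_coe, List.mem_toFinset]
  refine mem_edges_of_dist_lt hp ?_
  have h := hlt i
  rcases Sym2.eq_iff.1 hi with ⟨h1, h2⟩ | ⟨h1, h2⟩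
  · rwa [h1, h2] at h
  · rwa [h1, h2, dist_comm, dist_comm (u := y)] at h

/-- The counting argument when the hull of the cycle has further vertices. -/
theorem false_of_pairs_of_four_mul_dist_le {n k : ℕ} (hn : 3 * n < 4 * k) {ι : Type*} [Nonempty ι]
    {B : Finset V} {h : V → ℕ} (hB : ∑ v ∈ B, h v + B.card ≤ n) {u w : ι → V} {D : ι → ℕ}
    (hu : ∀ i, u i ∈ B) (hw : ∀ i, w i ∈ B) (huw : ∀ i, u i ≠ w i)
    (hstar : ∀ v, ∃ i, u i ≠ v ∧ w i ≠ v) (hD : ∀ i, 4 * D i ≤ 3 * B.card)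
    (hk : ∀ i, k + 1 ≤ h (u i) + h (w i) + D i) : False := by
  rcases Finset.disjoint_pairs_or_triangle huw hstar with
    ⟨i, j, h1, h2, h3, h4⟩ | ⟨x, y, z, hxy, hyz, hxz, ⟨i, hi⟩, ⟨j, hj⟩, ⟨l, hl⟩, -⟩
  · have := Finset.add_four_le_sum h (hu i) (hw i) (hu j) (hw j) (huw i) h1 h2 h3 h4 (huw j)
    have := hD i
    have := hD j
    have := hk i
    have := hk j
    -- With `S = ∑ h`, two disjoint pairs give `8 * (k + 1) ≤ 4 * S + 6 * |B| ≤ 6 * n`.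
    omega
  · have key : ∀ i x y, s(u i, w i) = s(x, y) →
        x ∈ B ∧ y ∈ B ∧ 4 * (k + 1) ≤ 4 * (h x + h y) + 3 * B.card := by
      intro i x y hi
      have h1 := hk i
      have h2 := hD i
      rcases Sym2.eq_iff.1 hi with ⟨rfl, rfl⟩ | ⟨rfl, rfl⟩
      · exact ⟨hu i, hw i, by omega⟩
      · exact ⟨hw i, hu i, by omega⟩
    obtain ⟨hx, hy, h1⟩ := key i x y hi
    obtain ⟨-, hz, h2⟩ := key j y z hj
    obtain ⟨-, -, h3⟩ := key l x z hl
    have := Finset.add_three_le_sum h hx hy hz hxy hxz hyz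
    -- The three sides give `12 * (k + 1) ≤ 8 * S + 9 * |B| ≤ 9 * n`, where `S = ∑ h`.
    omega

/-- The counting argument when the cycle is its own hull. -/
theorem false_of_pairs_of_range {n k : ℕ} (hn : 3 * n < 4 * k) (hg : 3 ≤ g) (hgk : g ≤ k + 1)
    (hf : Function.Injective f) (hadj : ∀ i, H.Adj (f i) (f (i + 1))) {B : Finset V}
    {h : V → ℕ} (hB : ∑ v ∈ B, h v + B.card ≤ n) (hBf : (B : Set V) = Set.range f)
    {u w : ZMod g → V} (hu : ∀ i, u i ∈ B) (hw : ∀ i, w i ∈ B) (huw : ∀ i, u i ≠ w i)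
    (hr : ∀ i, H.Reachable (u i) (w i))
    (hlt : ∀ i, H.dist (u i) (w i) < (H.deleteEdges {s(f i, f (i + 1))}).dist (u i) (w i))
    (hstar : ∀ v, ∃ i, u i ≠ v ∧ w i ≠ v)
    (hk : ∀ i, k + 1 ≤ h (u i) + h (w i) +
      (H.deleteEdges {s(f i, f (i + 1))}).dist (u i) (w i)) : False := by
  classical
  have : NeZero g := ⟨by omega⟩
  have hBim : B = Finset.univ.image f := by
    ext x
    rw [← Finset.mem_coe, hBf]
    simp
  have hBc : B.card = g := by
    rw [hBim, Finset.card_image_of_injective _ hf, Finset.card_univ, ZMod.card]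
  have hmem : ∀ v ∈ B, ∃ a, f a = v := fun v hv => by
    rw [← Finset.mem_coe, hBf] at hv; exact hv
  have harc : ∀ i, ∃ s t : ℕ, H.dist (u i) (w i) ≤ s + t + 1 ∧
      k + 1 + (s + t + 1) ≤ h (f (i - s)) + h (f (i + 1 + t)) + g ∧
      h (f (i - s)) + h (f (i + 1 + t)) = h (u i) + h (w i) := by
    intro i
    obtain ⟨a, ha⟩ := hmem _ (hu i)
    obtain ⟨c, hc⟩ := hmem _ (hw i)
    obtain ⟨s, t, hst, hac⟩ := ZMod.exists_arc_through i a c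
    have h1 := dist_deleteEdges_le_arc hg hf hadj i hst
    have h2 := hk i
    have h3 := dist_le_arc hadj (i - s) (s + t + 1)
    have h4 : i - (s : ZMod g) + ((s + t + 1 : ℕ) : ZMod g) = i + 1 + t := by push_cast; ring
    rw [h4] at h3
    refine ⟨s, t, ?_⟩
    rcases hac with ⟨e1, e2⟩ | ⟨e1, e2⟩
    · rw [e1, e2, ha, hc] at h1 h3 ⊢
      exact ⟨h3, by omega, rfl⟩
    · rw [e1, e2, ha, hc, dist_comm] at h1 h3
      rw [e1, e2, ha, hc]
      exact ⟨h3, by omega, by omega⟩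
  -- The excess `κ` turns the pair inequality into: arc length plus `κ` is at most `h (u i) + h (w
  -- i)`. Taking `κ / 2` off each value of `h` leaves enough to cover the arc, hence edge `i`.
  obtain ⟨κ, hκ⟩ : ∃ κ, k + 1 = g + κ := ⟨k + 1 - g, by omega⟩
  have hcover := ZMod.le_two_mul_sum (g := g) (fun j => h (f j) - κ / 2) fun i => by
    obtain ⟨s, t, -, hst, -⟩ := harc i
    exact ⟨s, t, by omega⟩
  have hsum : ∑ j : ZMod g, (h (f j) - κ / 2) = ∑ v ∈ B, (h v - κ / 2) := by
    rw [hBim, Finset.sum_image hf.injOn]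
  rw [hsum] at hcover
  have hpair : ∀ i, H.dist (u i) (w i) + κ ≤ h (u i) + h (w i) := fun i => by
    obtain ⟨s, t, h1, h2, h3⟩ := harc i
    omega
  have hbig : ∀ i, κ / 2 ≤ h (u i) ∨ κ / 2 ≤ h (w i) := fun i => by
    have := hpair i
    omega
  rcases Finset.disjoint_pairs_or_triangle huw hstar with
    ⟨i, j, h1, h2, h3, h4⟩ | ⟨x, y, z, hxy, hyz, hxz, ⟨i, hi⟩, ⟨j, hj⟩, ⟨l, hl⟩, hall⟩
  · have hS := Finset.add_four_le_sum h (hu i) (hw i) (hu j) (hw j) (huw i) h1 h2 h3 h4 (huw j)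
    have hi := hpair i
    have hj := hpair j
    have hi0 := (hr i).pos_dist_of_ne (huw i)
    have hj0 := (hr j).pos_dist_of_ne (huw j)
    have hred : ∑ v ∈ B, (h v - κ / 2) + 2 * (κ / 2) ≤ ∑ v ∈ B, h v := by
      rcases hbig i with hi | hi <;> rcases hbig j with hj | hj
      · exact Finset.sum_tsub_add_two_mul_le h (hu i) (hu j) h1 hi hj
      · exact Finset.sum_tsub_add_two_mul_le h (hu i) (hw j) h2 hi hj
      · exact Finset.sum_tsub_add_two_mul_le h (hw i) (hu j) h3 hi hj
      · exact Finset.sum_tsub_add_two_mul_le h (hw i) (hw j) h4 hi hj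
    -- With `S = ∑ h`: covering and `hred` give `g + 4 * (κ / 2) ≤ 2 * S`, where `4 * (κ / 2) ≥ 2 *
    -- κ - 2`, and the two pairs give `2 * κ + 2 ≤ S`. Adding, `g + 4 * κ ≤ 3 * S`, so `3 * n ≥ 3 *
    -- g + 3 * S ≥ 4 * (k + 1)`.
    omega
  · have key : ∀ i x y, s(u i, w i) = s(x, y) → x ∈ B ∧ y ∈ B ∧
        (Finset.univ.filter fun i => s(u i, w i) = s(x, y)).card + κ ≤ h x + h y := by
      intro i x y hi
      have h1 := hpair i
      rcases Sym2.eq_iff.1 hi with ⟨rfl, rfl⟩ | ⟨rfl, rfl⟩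
      · have h2 := card_filter_pair_le hg hf hlt (hr i)
        exact ⟨hu i, hw i, by omega⟩
      · have h2 := card_filter_pair_le hg hf hlt (hr i).symm
        rw [dist_comm] at h2
        exact ⟨hw i, hu i, by omega⟩
    obtain ⟨hx, hy, h1⟩ := key i x y hi
    obtain ⟨-, hz, h2⟩ := key j y z hj
    obtain ⟨-, -, h3⟩ := key l x z hl
    have hS := Finset.add_three_le_sum h hx hy hz hxy hxz hyz
    have huniv : (Finset.univ : Finset (ZMod g)) ⊆
        (Finset.univ.filter fun i => s(u i, w i) = s(x, y)) ∪
        ((Finset.univ.filter fun i => s(u i, w i) = s(y, z)) ∪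
        (Finset.univ.filter fun i => s(u i, w i) = s(x, z))) := fun i _ => by
      simpa using hall i
    have hc := (Finset.card_le_card huniv).trans (Finset.card_union_le _ _)
    have hc' := Finset.card_union_le (Finset.univ.filter fun i => s(u i, w i) = s(y, z))
      (Finset.univ.filter fun i => s(u i, w i) = s(x, z))
    rw [Finset.card_univ, ZMod.card] at hc
    -- The three classes contain all `g` edges, so `g + 3 * κ ≤ 2 * ∑ h`, which again makes `3 * n`
    -- at least `4 * (k + 1)`.
    omega

end Cycle

theorem Walk.IsCycle.exists_injective_zmod {v : V} {c : H.Walk v v} (hc : c.IsCycle) :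
    ∃ f : ZMod c.length → V, Function.Injective f ∧ ∀ i, H.Adj (f i) (f (i + 1)) := by
  have hg := hc.three_le_length
  have : NeZero c.length := ⟨by omega⟩
  refine ⟨fun i => c.getVert i.val, fun i j hij => ?_, fun i => ?_⟩
  · have hi := ZMod.val_lt i
    have hj := ZMod.val_lt j
    exact ZMod.val_injective _ (hc.getVert_injOn' (by simp only [Set.mem_ofPred_eq]; omega)
      (by simp only [Set.mem_ofPred_eq]; omega) hij)
  · have hi := ZMod.val_lt i
    have h1 := c.adj_getVert_succ hi
    have h2 : c.getVert (i + 1).val = c.getVert (i.val + 1) := by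
      have h3 : (i + 1).val = (i.val + 1) % c.length := by
        rw [ZMod.val_add, ZMod.val_one_eq_one_mod, Nat.add_mod_mod]
      rw [h3]
      rcases Nat.lt_or_ge (i.val + 1) c.length with h | h
      · rw [Nat.mod_eq_of_lt h]
      · have h4 : i.val + 1 = c.length := by omega
        rw [h4, Nat.mod_self, Walk.getVert_zero, Walk.getVert_length]
    change H.Adj (c.getVert i.val) (c.getVert (i + 1).val)
    rw [h2]
    exact h1

end SimpleGraph

/-! ### Inclusion-minimal spanners -/

section Spanner

open SimpleGraph

/-- Along a shortest walk of `G` each edge is replaced by a connection of length at most `k`.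
Positivity of `k` matters for unreachable pairs, since `0 * ⊤ = 0`. -/
theorem isSpanner_iff_adj {V : Type*} {k : ℕ} (hk : 0 < k) {G H : SimpleGraph V} :
    IsSpanner k G H ↔ H ≤ G ∧ ∀ x y, G.Adj x y → H.edist x y ≤ k := by
  refine and_congr_right fun _ => ⟨fun h x y hxy => ?_, fun h x y => ?_⟩
  · simpa [edist_eq_one_iff_adj.2 hxy] using h x y
  · by_cases hr : G.Reachable x y
    · obtain ⟨p, hp⟩ := hr.exists_walk_length_eq_edist
      rw [← hp]
      clear hp hr
      induction p with
      | nil => simp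
      | @cons a b c hab p ih =>
        refine SimpleGraph.edist_triangle.trans ((add_le_add (h a b hab) ih).trans (le_of_eq ?_))
        rw [Walk.length_cons]
        push_cast
        ring
    · rw [edist_eq_top_of_not_reachable hr, ENat.mul_top (by exact_mod_cast hk.ne')]
      exact le_top

theorem IsSpanner.mono {V : Type*} {k : ℕ} {G H H' : SimpleGraph V} (h : IsSpanner k G H)
    (hH : H ≤ H') (hG : H' ≤ G) : IsSpanner k G H' :=
  ⟨hG, fun u v => (edist_anti hH).trans (h.2 u v)⟩

/-- A `k`-spanner all of whose edges are needed has girth at least `k + 2` if `k` is larger than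
three quarters of the number of vertices. -/
theorem IsSpanner.le_egirth {V : Type*} [Fintype V] {k : ℕ} {G H : SimpleGraph V}
    (hn : 3 * Fintype.card V < 4 * k) (hH : IsSpanner k G H)
    (hmin : ∀ e ∈ H.edgeSet, ¬ IsSpanner k G (H.deleteEdges {e})) :
    ((k + 2 : ℕ) : ℕ∞) ≤ H.egirth := by
  classical
  by_contra! hlt
  obtain ⟨v, c, hc, hgc⟩ := exists_egirth_eq_length.2 fun hac => by
    rw [hac.egirth_eq_top] at hlt
    exact not_top_lt hlt
  have hcmin : ∀ (v : V) (c' : H.Walk v v), c'.IsCycle → c.length ≤ c'.length := fun v c' hc' => by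
    have := egirth_le_length hc'
    rw [hgc] at this
    exact_mod_cast this
  have hgk : c.length ≤ k + 1 := by
    rw [hgc] at hlt
    have : c.length < k + 2 := by exact_mod_cast hlt
    omega
  have hg := hc.three_le_length
  obtain ⟨f, hf, hadj⟩ := hc.exists_injective_zmod
  generalize c.length = g at *
  clear hc
  have : NeZero g := ⟨by omega⟩
  obtain ⟨B, hB⟩ : ∃ B : Finset V, (B : Set V) = pathHull H (Set.range f) :=
    ⟨(Set.toFinite (pathHull H (Set.range f))).toFinset, by simp⟩
  have hfB : ∀ j, f j ∈ B := fun j => by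
    rw [← Finset.mem_coe, hB]
    exact subset_pathHull _ ⟨j, rfl⟩
  have hBc : PathClosed H (B : Set V) := hB ▸ pathClosed_pathHull _
  have hloc : ∀ i j, (H.deleteEdges {s(f i, f (i + 1))}).Reachable (f i) (f j) := fun i j =>
    (exists_walk_range hg hf hadj i i j).choose.reachable
  have hreach : ∀ x ∈ B, H.Reachable (f 0) x := fun x hx => by
    refine reachable_of_mem_pathHull (C := Set.range f) ?_ (hB ▸ hx)
    rintro _ ⟨j, rfl⟩
    exact (hloc 0 j).mono (deleteEdges_le _)
  have hreachK : ∀ i, ∀ x ∈ B, ∀ y ∈ B, (H.deleteEdges {s(f i, f (i + 1))}).Reachable x y :=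
    fun i x hx y hy =>
      reachable_deleteEdges (hloc i (i + 1)) ((hreach x hx).symm.trans (hreach y hy))
  have hpairs : ∀ i, ∃ u ∈ (B : Set V), ∃ w ∈ (B : Set V), H.Reachable u w ∧
      H.dist u w < (H.deleteEdges {s(f i, f (i + 1))}).dist u w ∧
      k + 1 ≤ branchSize H B u + branchSize H B w +
        (H.deleteEdges {s(f i, f (i + 1))}).dist u w := by
    intro i
    have hnot := hmin s(f i, f (i + 1)) (hadj i)
    rw [isSpanner_iff_adj (by omega)] at hnot
    rw [isSpanner_iff_adj (by omega)] at hH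
    push Not at hnot
    obtain ⟨x, y, hxy, hlong⟩ := hnot ((deleteEdges_le _).trans hH.1)
    have hshort := hH.2 x y hxy
    obtain ⟨P, hP⟩ := exists_walk_of_edist_ne_top (ne_top_of_le_ne_top (ENat.natCast_ne_top k)
      hshort)
    refine exists_dist_lt_of_lt_length (hfB i) (hfB (i + 1)) (hloc i (i + 1)) P
      (by rw [← hP] at hshort; exact_mod_cast hshort) fun q => ?_
    have := hlong.trans_le (edist_le q)
    exact_mod_cast this
  choose u hu w hw hr hlt' hk' using hpairs
  have huw : ∀ i, u i ≠ w i := fun i h => by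
    have := hlt' i
    rw [h, dist_self, dist_self] at this
    exact lt_irrefl _ this
  have hstar : ∀ v, ∃ i, u i ≠ v ∧ w i ≠ v := by
    intro v
    obtain ⟨i, hi⟩ := exists_edge_not_dist_lt hg hf hadj v
    refine ⟨i, fun h => ?_, fun h => ?_⟩
    · exact hi (w i) (h ▸ hr i) (h ▸ hlt' i)
    · refine hi (u i) (h ▸ (hr i).symm) ?_
      rw [dist_comm, dist_comm (u := v), ← h]
      exact hlt' i
  have hcount := hBc.sum_branchSize_add_card_le
  by_cases hcl : PathClosed H (Set.range f)
  · have hBf : (B : Set V) = Set.range f := by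
      rw [hB]
      exact (pathHull_subset hcl subset_rfl).antisymm (subset_pathHull _)
    exact false_of_pairs_of_range hn hg hgk hf hadj hcount hBf hu hw huw hr hlt' hstar hk'
  · exact false_of_pairs_of_four_mul_dist_le hn hcount hu hw huw hstar
      (fun i => four_mul_dist_le hg hf hadj hcmin hB hcl i (hu i) (hw i)
        fun x hx => hreachK i _ (hu i) x hx) hk'

theorem isExtremelyGood_of_lt {n k : ℕ} (h : 3 * n < 4 * k) : IsExtremelyGood n k := by
  intro V _ hV G H hH
  subst hV
  refine hH.1.le_egirth h fun e he hS => ?_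
  have h1 := hH.2 _ hS
  rw [edgeSet_deleteEdges] at h1
  have h2 := Set.ncard_sdiff_singleton_lt_of_mem he (Set.toFinite _)
  omega

end Spanner

/-! ### Reasoning about programs of the random-access machine -/

namespace RAM

/-- The registers that a program may change. -/
def Prog.writes : Prog → List ℕ
  | .skip => []
  | .const d _ => [d]
  | .add d _ _ => [d]
  | .sub d _ _ => [d]
  | .load d _ => [d]
  | .store _ _ => []
  | .seq P Q => P.writes ++ Q.writes
  | .ite _ P Q => P.writes ++ Q.writes
  | .loop _ P => P.writes

theorem Exec.reg_eq {P : Prog} {s s' : State} {t : ℕ} (h : Exec P s t s') {r : ℕ}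
    (hr : r ∉ P.writes) : s'.reg r = s.reg r := by
  induction h with
  | skip | store | loop_done => rfl
  | const | add | sub | load =>
    simp only [Prog.writes, List.mem_singleton] at hr
    exact Function.update_of_ne hr _ _
  | seq _ _ ihP ihQ =>
    simp only [Prog.writes, List.mem_append, not_or] at hr
    rw [ihQ hr.2, ihP hr.1]
  | ite_true _ _ ih =>
    simp only [Prog.writes, List.mem_append, not_or] at hr
    exact ih hr.1
  | ite_false _ _ ih =>
    simp only [Prog.writes, List.mem_append, not_or] at hr
    exact ih hr.2
  | loop_step _ _ _ ihP ihQ => rw [ihQ hr, ihP hr]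

/-- Started in `s`, the program `P` halts within `T` steps in a state satisfying `Q`. -/
def Runs (P : Prog) (s : State) (T : ℕ) (Q : State → Prop) : Prop :=
  ∃ (t : ℕ) (s' : State), Exec P s t s' ∧ t ≤ T ∧ Q s'

theorem Runs.mono {P : Prog} {s : State} {T T' : ℕ} {Q Q' : State → Prop} (h : Runs P s T Q)
    (hT : T ≤ T') (hQ : ∀ s', (∀ r, r ∉ P.writes → s'.reg r = s.reg r) → Q s' → Q' s') :
    Runs P s T' Q' := by
  obtain ⟨t, s', he, ht, hq⟩ := h
  exact ⟨t, s', he, ht.trans hT, hQ s' (fun _ hr => he.reg_eq hr) hq⟩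

theorem Runs.skip {s : State} {Q : State → Prop} (h : Q s) : Runs .skip s 1 Q :=
  ⟨1, s, .skip s, le_rfl, h⟩

theorem Runs.const {d c : ℕ} {s : State} {Q : State → Prop} (h : Q (s.setReg d c)) :
    Runs (.const d c) s 1 Q :=
  ⟨1, _, .const d c s, le_rfl, h⟩

theorem Runs.add {d a b : ℕ} {s : State} {Q : State → Prop}
    (h : Q (s.setReg d (s.reg a + s.reg b))) : Runs (.add d a b) s 1 Q :=
  ⟨1, _, .add d a b s, le_rfl, h⟩

theorem Runs.sub {d a b : ℕ} {s : State} {Q : State → Prop}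
    (h : Q (s.setReg d (s.reg a - s.reg b))) : Runs (.sub d a b) s 1 Q :=
  ⟨1, _, .sub d a b s, le_rfl, h⟩

theorem Runs.load {d a : ℕ} {s : State} {Q : State → Prop}
    (h : Q (s.setReg d (s.mem (s.reg a)))) : Runs (.load d a) s 1 Q :=
  ⟨1, _, .load d a s, le_rfl, h⟩

theorem Runs.store {a b : ℕ} {s : State} {Q : State → Prop}
    (h : Q (s.setMem (s.reg a) (s.reg b))) : Runs (.store a b) s 1 Q :=
  ⟨1, _, .store a b s, le_rfl, h⟩

theorem Runs.seq {P P' : Prog} {s : State} {T T' : ℕ} {Q : State → Prop}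
    (h : Runs P s T fun s' => Runs P' s' T' Q) : Runs (.seq P P') s (T + T') Q := by
  obtain ⟨t, s₁, he, ht, t', s₂, he', ht', hq⟩ := h
  exact ⟨t + t', s₂, .seq he he', Nat.add_le_add ht ht', hq⟩

theorem Runs.ite {r : ℕ} {P P' : Prog} {s : State} {T : ℕ} {Q : State → Prop}
    (h : s.reg r ≠ 0 → Runs P s T Q) (h' : s.reg r = 0 → Runs P' s T Q) :
    Runs (.ite r P P') s (T + 1) Q := by
  by_cases hr : s.reg r = 0
  · obtain ⟨t, s', he, ht, hq⟩ := h' hr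
    exact ⟨t + 1, s', .ite_false hr he, Nat.add_le_add_right ht 1, hq⟩
  · obtain ⟨t, s', he, ht, hq⟩ := h hr
    exact ⟨t + 1, s', .ite_true hr he, Nat.add_le_add_right ht 1, hq⟩

/-- For `r` from `reg b - 1` down to `0` do `P`. Register `2` has to hold `1` and register `7`
has to hold `0`. -/
def Prog.forN (r b : ℕ) (P : Prog) : Prog :=
  .seq (.add r b 7) (.loop r (.seq (.sub r r 2) P))

/-- The body starts after the counter has been decremented, while the invariant `I (m + 1)` speaks
of the state before; hence the auxiliary state `s'` in `hbody`. -/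
theorem Runs.loop_countdown {r : ℕ} {P : Prog} {s₀ : State} {n T : ℕ}
    {I : ℕ → State → Prop} (hr : r ∉ P.writes) (h2 : 2 ∉ P.writes) (hr2 : r ≠ 2)
    (hone : s₀.reg 2 = 1)
    (hbody : ∀ m < n, ∀ s : State, (∀ q, q ≠ r → q ∉ P.writes → s.reg q = s₀.reg q) →
      s.reg r = m → (∃ s', s = s'.setReg r m ∧ I (m + 1) s') → Runs P s T (I m)) :
    ∀ m ≤ n, ∀ s : State, (∀ q, q ≠ r → q ∉ P.writes → s.reg q = s₀.reg q) → s.reg r = m →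
      I m s → Runs (.loop r (.seq (.sub r r 2) P)) s (m * (T + 2) + 1) (I 0) := by
  intro m
  induction m with
  | zero =>
    intro _ s _ h0 hI
    exact ⟨1, s, .loop_done h0, by omega, hI⟩
  | succ m ih =>
    intro hm s hs h0 hI
    have h1 : s.reg 2 = 1 := by rw [hs 2 hr2.symm h2, hone]
    have hs1 : ∀ q, q ≠ r → q ∉ P.writes → (s.setReg r m).reg q = s₀.reg q := fun q hq hqP => by
      rw [← hs q hq hqP]
      exact Function.update_of_ne hq _ _
    obtain ⟨t₁, s₁, he₁, ht₁, hI₁⟩ := hbody m (by omega) (s.setReg r m) hs1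
      (Function.update_self _ _ _) ⟨s, rfl, hI⟩
    obtain ⟨t₂, s₂, he₂, ht₂, hI₂⟩ := ih (by omega) s₁
      (fun q hq hqP => by rw [he₁.reg_eq hqP, hs1 q hq hqP])
      (by rw [he₁.reg_eq hr]; exact Function.update_self _ _ _) hI₁
    have hsub : Exec (.sub r r 2) s 1 (s.setReg r m) := by
      have := Exec.sub r r 2 s
      rwa [h0, h1, Nat.add_sub_cancel] at this
    refine ⟨1 + t₁ + t₂ + 1, s₂, .loop_step (by omega) (.seq hsub he₁) he₂, ?_, hI₂⟩
    have : (m + 1) * (T + 2) = m * (T + 2) + (T + 2) := by ring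
    omega

/-- The rule for counting loops with an invariant on the memory. -/
theorem Runs.forN {r b : ℕ} {P : Prog} {s : State} {n T : ℕ} {I : ℕ → (ℕ → ℕ) → Prop}
    (hn : s.reg b = n) (hone : s.reg 2 = 1) (hzero : s.reg 7 = 0)
    (hw : r ≠ 2 ∧ r ∉ P.writes ∧ 2 ∉ P.writes) (h0 : I n s.mem)
    (hbody : ∀ m < n, ∀ s' : State, (∀ q, q ≠ r → q ∉ P.writes → s'.reg q = s.reg q) →
      s'.reg r = m → I (m + 1) s'.mem → Runs P s' T fun s'' => I m s''.mem) :
    Runs (.forN r b P) s (n * (T + 2) + 2) fun s' => I 0 s'.mem := by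
  refine Runs.mono (T := 1 + (n * (T + 2) + 1)) (Runs.seq (Runs.add ?_)) (by omega)
    fun _ _ h => h
  rw [hn, hzero, Nat.add_zero]
  have hreg : ∀ q, q ≠ r → (s.setReg r n).reg q = s.reg q := fun q hq =>
    Function.update_of_ne hq _ _
  refine Runs.loop_countdown (I := fun m s => I m s.mem) (n := n) hw.2.1 hw.2.2 hw.1
    (by rw [hreg 2 hw.1.symm, hone]) ?_ n le_rfl _ (fun _ _ _ => rfl)
    (Function.update_self _ _ _) h0
  rintro m hm s' hs' hm' ⟨s'', rfl, hI⟩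
  exact hbody m hm _ (fun q hq hqP => by rw [hs' q hq hqP, hreg q hq]) hm' hI

/-- The rule for counting loops that collect one property per iteration, where the properties are
inherited along a preorder in which the memory only descends. -/
theorem Runs.forN_forall {α : Type*} [Preorder α] (φ : (ℕ → ℕ) → α) (J : (ℕ → ℕ) → Prop)
    (Q : ℕ → α → Prop) (hQ : ∀ m x y, x ≤ y → Q m y → Q m x)
    {r b : ℕ} {P : Prog} {s : State} {n T : ℕ}
    (hn : s.reg b = n) (hone : s.reg 2 = 1) (hzero : s.reg 7 = 0)
    (hw : r ≠ 2 ∧ r ∉ P.writes ∧ 2 ∉ P.writes) (h0 : J s.mem)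
    (hbody : ∀ m < n, ∀ s' : State, (∀ q, q ≠ r → q ∉ P.writes → s'.reg q = s.reg q) →
      s'.reg r = m → J s'.mem →
      Runs P s' T fun s'' => J s''.mem ∧ φ s''.mem ≤ φ s'.mem ∧ Q m (φ s''.mem)) :
    Runs (.forN r b P) s (n * (T + 2) + 2) fun s' =>
      J s'.mem ∧ φ s'.mem ≤ φ s.mem ∧ ∀ m < n, Q m (φ s'.mem) := by
  refine (Runs.forN (I := fun m μ => J μ ∧ φ μ ≤ φ s.mem ∧ ∀ l, m ≤ l → l < n → Q l (φ μ))
    hn hone hzero hw ⟨h0, le_rfl, fun l h1 h2 => absurd h2 (by omega)⟩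
    fun m hm s' hs' hr hI => ?_).mono le_rfl fun s' _ h => ⟨h.1, h.2.1, fun m hm =>
      h.2.2 m (Nat.zero_le m) hm⟩
  refine (hbody m hm s' hs' hr hI.1).mono le_rfl fun s'' _ h =>
    ⟨h.1, h.2.1.trans hI.2.1, fun l hl hln => ?_⟩
  rcases hl.eq_or_lt with rfl | hl
  · exact h.2.2
  · exact hQ l _ _ h.2.1 (hI.2.2 l hl hln)

/-! ### Access to the cells of a matrix -/

/-- `reg d := reg base + reg i * reg 0 + reg j`, with register `29` as a counter. -/
def Prog.addr (d base i j : ℕ) : Prog :=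
  .seq (.add d base j) (.forN 29 i (.add d d 0))

/-- The final state of `Prog.addr`. -/
def State.addr (s : State) (d base i j : ℕ) : State :=
  (s.setReg 29 0).setReg d (s.reg base + s.reg i * s.reg 0 + s.reg j)

theorem Runs.addr {d base i j n : ℕ} {s : State} {Q : State → Prop} (hone : s.reg 2 = 1)
    (hzero : s.reg 7 = 0) (hi : s.reg i ≤ n) (hd : 7 < d ∧ d ≠ 29 ∧ d ≠ i)
    (h : Q (s.addr d base i j)) :
    Runs (.addr d base i j) s (3 * n + 3) Q := by
  set x := s.reg base + s.reg j with hx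
  have key : Runs (.loop 29 (.seq (.sub 29 29 2) (.add d d 0)))
      ((s.setReg d x).setReg 29 (s.reg i)) (s.reg i * (1 + 2) + 1)
      (fun s' => s' = (s.setReg d (x + (s.reg i - 0) * s.reg 0)).setReg 29 0) := by
    refine Runs.loop_countdown (n := s.reg i) (s₀ := (s.setReg d x).setReg 29 (s.reg i))
      (I := fun m s' => s' = (s.setReg d (x + (s.reg i - m) * s.reg 0)).setReg 29 m)
      (by simp [Prog.writes]; omega) (by simp [Prog.writes]; omega) (by omega) ?_ ?_ _ le_rfl _
      (fun _ _ _ => rfl) (by simp [State.setReg]) (by simp)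
    · simp only [State.setReg]
      rw [Function.update_of_ne (by omega), Function.update_of_ne (by omega), hone]
    · rintro m hm s' hs' hm' ⟨s'', rfl, rfl⟩
      refine Runs.add ?_
      have h1 : s.reg i - m = s.reg i - (m + 1) + 1 := by omega
      simp only [State.setReg, State.mk.injEq, and_true]
      ext q
      rw [h1]
      simp only [Function.update_apply]
      have h0d : (0 : ℕ) ≠ d := by omega
      split_ifs <;> first | rfl | contradiction | omega | ring
  refine Runs.mono (T := 1 + (1 + (s.reg i * (1 + 2) + 1))) (Runs.seq (Runs.add
    (Runs.seq (Runs.add ?_)))) (by omega) (fun _ _ h => h)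
  have h1 : (s.setReg d (s.reg base + s.reg j)).reg i +
      (s.setReg d (s.reg base + s.reg j)).reg 7 = s.reg i := by
    simp only [State.setReg]
    rw [Function.update_of_ne (by omega), Function.update_of_ne (by omega), hzero, Nat.add_zero]
  rw [h1]
  refine key.mono le_rfl fun s' _ hs' => ?_
  convert h using 1
  rw [hs']
  simp only [State.addr, State.setReg, State.mk.injEq, and_true]
  ext q
  simp only [Function.update_apply]
  split_ifs <;> first | rfl | contradiction | omega | (rw [hx]; simp; ring)

/-- `reg d := mem (reg base + reg i * reg 0 + reg j)`. -/
def Prog.loadCell (d base i j : ℕ) : Prog := .seq (.addr 28 base i j) (.load d 28)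

/-- `mem (reg base + reg i * reg 0 + reg j) := reg v`. -/
def Prog.storeCell (base i j v : ℕ) : Prog := .seq (.addr 28 base i j) (.store 28 v)

theorem Runs.loadCell {d base i j n : ℕ} {s : State} {Q : State → Prop} (hone : s.reg 2 = 1)
    (hzero : s.reg 7 = 0) (hi : s.reg i ≤ n) (hi' : i < 28)
    (h : Q ((s.addr 28 base i j).setReg d (s.mem (s.reg base + s.reg i * s.reg 0 + s.reg j)))) :
    Runs (.loadCell d base i j) s (3 * n + 4) Q := by
  refine Runs.seq (T := 3 * n + 3) (T' := 1) (Runs.addr (d := 28) hone hzero hi (by omega) (Runs.load ?_))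
  simpa [State.addr, State.setReg] using h

theorem Runs.storeCell {base i j v n : ℕ} {s : State} {Q : State → Prop} (hone : s.reg 2 = 1)
    (hzero : s.reg 7 = 0) (hi : s.reg i ≤ n) (hi' : i < 28) (hv : v < 28)
    (h : Q ((s.addr 28 base i j).setMem (s.reg base + s.reg i * s.reg 0 + s.reg j) (s.reg v))) :
    Runs (.storeCell base i j v) s (3 * n + 4) Q := by
  refine Runs.seq (T := 3 * n + 3) (T' := 1) (Runs.addr (d := 28) hone hzero hi (by omega) (Runs.store ?_))
  have h1 : (s.addr 28 base i j).reg v = s.reg v := by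
    simp only [State.addr, State.setReg]
    rw [Function.update_of_ne (by omega), Function.update_of_ne (by omega)]
  rw [h1]
  simpa [State.addr, State.setReg] using h

end RAM

/-! ### Reading off states, and the constants held in registers -/

namespace RAM

@[simp] theorem State.reg_setReg (s : State) (d x r : ℕ) :
    (s.setReg d x).reg r = if r = d then x else s.reg r := Function.update_apply _ _ _ _

@[simp] theorem State.reg_setMem (s : State) (a x : ℕ) : (s.setMem a x).reg = s.reg := rfl

@[simp] theorem State.mem_setReg (s : State) (d x : ℕ) : (s.setReg d x).mem = s.mem := rfl

@[simp] theorem State.mem_setMem (s : State) (a x : ℕ) :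
    (s.setMem a x).mem = Function.update s.mem a x := rfl

@[simp] theorem State.mem_addr (s : State) (d b i j : ℕ) : (s.addr d b i j).mem = s.mem := rfl

@[simp] theorem State.reg_addr (s : State) (d b i j r : ℕ) :
    (s.addr d b i j).reg r = if r = d then s.reg b + s.reg i * s.reg 0 + s.reg j else
      if r = 29 then 0 else s.reg r := by
  simp [State.addr]

/-- The constants that the algorithm keeps in its first registers: the parameters, `0`, `1`, a bound
for infinity, and the addresses of the matrices. -/
structure Ready (n k : ℕ) (s : State) : Prop where
  r0 : s.reg 0 = n
  r1 : s.reg 1 = k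
  r2 : s.reg 2 = 1
  r3 : s.reg 3 = n * n
  r4 : s.reg 4 = n * n + n * n
  r5 : s.reg 5 = k + 1
  r6 : s.reg 6 = n * n + n * n + n * n
  r7 : s.reg 7 = 0

theorem Ready.of_eq {n k : ℕ} {s s' : State} (h : Ready n k s)
    (h' : ∀ q < 8, s'.reg q = s.reg q) : Ready n k s' :=
  ⟨(h' 0 (by omega)).trans h.r0, (h' 1 (by omega)).trans h.r1, (h' 2 (by omega)).trans h.r2,
    (h' 3 (by omega)).trans h.r3, (h' 4 (by omega)).trans h.r4, (h' 5 (by omega)).trans h.r5,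
    (h' 6 (by omega)).trans h.r6, (h' 7 (by omega)).trans h.r7⟩

theorem Ready.of_frame {n k : ℕ} {s s' : State} {r : ℕ} {P : Prog} (h : Ready n k s)
    (h' : ∀ q, q ≠ r → q ∉ P.writes → s'.reg q = s.reg q)
    (hP : ∀ q < 8, q ≠ r ∧ q ∉ P.writes) : Ready n k s' :=
  h.of_eq fun q hq => h' q (hP q hq).1 (hP q hq).2

/-! ### Matrices in memory -/

theorem cell_lt {n i j : ℕ} (hi : i < n) (hj : j < n) : i * n + j < n * n := by
  have : (i + 1) * n ≤ n * n := Nat.mul_le_mul_right n hi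
  have : (i + 1) * n = i * n + n := by ring
  omega

theorem cell_inj {n i j i' j' : ℕ} (hj : j < n) (hj' : j' < n)
    (h : i * n + j = i' * n + j') : i = i' ∧ j = j' := by
  have hn : 0 < n := by omega
  have h1 := congrArg (· / n) h
  have h2 := congrArg (· % n) h
  simp only [Nat.add_comm (_ * n), Nat.add_mul_div_right _ _ hn, Nat.div_eq_of_lt hj,
    Nat.div_eq_of_lt hj', Nat.add_mul_mod_self_right, Nat.mod_eq_of_lt hj,
    Nat.mod_eq_of_lt hj'] at h1 h2
  omega

open Classical in
/-- From address `base` on, the memory holds the adjacency matrix of `R`. -/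
def Enc {n : ℕ} (base : ℕ) (μ : ℕ → ℕ) (R : SimpleGraph (Fin n)) : Prop :=
  ∀ i j : Fin n, μ (base + i * n + j) = if R.Adj i j then 1 else 0

theorem Enc.congr {n base : ℕ} {μ ν : ℕ → ℕ} {R : SimpleGraph (Fin n)} (h : Enc base μ R)
    (hν : ∀ a, base ≤ a → a < base + n * n → ν a = μ a) : Enc base ν R := fun i j => by
  have := cell_lt i.2 j.2
  rw [← h i j]
  exact hν _ (by omega) (by omega)

theorem Enc.update {n base a x : ℕ} {μ : ℕ → ℕ} {R : SimpleGraph (Fin n)} (h : Enc base μ R)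
    (ha : a < base ∨ base + n * n ≤ a) : Enc base (Function.update μ a x) R :=
  h.congr fun b _ _ => Function.update_of_ne (by omega) _ _

theorem Enc.ne_zero_iff {n base : ℕ} {μ : ℕ → ℕ} {R : SimpleGraph (Fin n)} (h : Enc base μ R)
    (i j : Fin n) : μ (base + i * n + j) ≠ 0 ↔ R.Adj i j := by
  rw [h i j]
  split_ifs with h' <;> simp [h']

/-- All edges of `G` have ends at distance at most `k` in `R`. -/
def Stretch {V : Type*} (k : ℕ) (G R : SimpleGraph V) : Prop :=
  ∀ x y, G.Adj x y → R.edist x y ≤ k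

theorem Stretch.mono {V : Type*} {k : ℕ} {G R R' : SimpleGraph V} (h : Stretch k G R)
    (hR : R ≤ R') : Stretch k G R' :=
  fun x y hxy => (SimpleGraph.edist_anti hR).trans (h x y hxy)

/-! ### Distances by relaxation -/

/-- The part of the memory from address `2 * n * n` on, which holds the distance matrix. -/
def distances (n : ℕ) (μ : ℕ → ℕ) (a : ℕ) : ℕ := μ (n * n + n * n + a)

theorem distances_update {n : ℕ} {μ : ℕ → ℕ} {a x : ℕ} :
    distances n (Function.update μ (n * n + n * n + a) x) =
      Function.update (distances n μ) a x := by
  ext b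
  simp [distances, Function.update_apply]

/-- Initialise the entry at `(reg 14, reg 15)` of the distance matrix. -/
def initCell : Prog :=
  -- Register `5` holds `k + 1`, which stands for infinity: only distances up to `k` matter.
  .seq (.loadCell 20 3 14 15) <| .seq (.ite 20 (.const 21 1) (.add 21 5 7)) <|
  -- The two truncated differences add up to zero exactly on the diagonal.
  .seq (.sub 22 14 15) <| .seq (.sub 23 15 14) <| .seq (.add 22 22 23) <|
  .seq (.ite 22 .skip (.const 21 0)) (.storeCell 4 14 15 21)

/-- Relax the entry at `(reg 14, reg 15)` of the distance matrix through the vertex `reg 13`. -/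
def relaxCell : Prog :=
  .seq (.loadCell 20 4 14 13) <| .seq (.loadCell 21 4 13 15) <| .seq (.add 20 20 21) <|
  -- The minimum of `a` and `b` is obtained as `a - (a - b)` with truncated subtraction.
  .seq (.loadCell 21 4 14 15) <| .seq (.sub 22 20 21) <| .seq (.sub 20 20 22)
  (.storeCell 4 14 15 20)

/-- Raise the flag if `(reg 14, reg 15)` is an edge of `G` whose ends are far apart. -/
def checkCell : Prog :=
  .seq (.loadCell 20 7 14 15) <| .seq (.loadCell 21 4 14 15) <| .seq (.sub 21 21 1)
  (.ite 20 (.ite 21 (.store 6 2) .skip) .skip)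

theorem Runs.initCell {n k : ℕ} {s : State} (hs : Ready n k s) {R : SimpleGraph (Fin n)}
    (hR : Enc (n * n) s.mem R) {u v : Fin n} (hu : s.reg 14 = u) (hv : s.reg 15 = v) :
    Runs RAM.initCell s (6 * n + 15) fun s' => ∃ x, s'.mem =
      Function.update s.mem (n * n + n * n + (u * n + v)) x ∧
      (u = v → x = 0) ∧ (u ≠ v → R.Adj u v → x = 1) ∧ (u ≠ v → ¬ R.Adj u v → x = k + 1) := by
  have hlt := u.2
  have hcell : s.mem (n * n + u * n + v) ≠ 0 ↔ R.Adj u v := hR.ne_zero_iff u v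
  have huv : (u : ℕ) - v + (v - u) ≠ 0 ↔ u ≠ v := by rw [Ne, Ne, Fin.ext_iff]; omega
  refine Runs.mono (T := (3 * n + 4) + ((1 + 1) + (1 + (1 + (1 + ((1 + 1) + (3 * n + 4)))))))
    ?_ (by omega) fun _ _ h => h
  refine Runs.seq (Runs.loadCell hs.r2 hs.r7 (by omega) (by omega) ?_)
  refine Runs.seq (Runs.ite (fun h1 => Runs.const ?_) (fun h1 => Runs.add ?_)) <;>
  refine Runs.seq (Runs.sub (Runs.seq (Runs.sub (Runs.seq (Runs.add (Runs.seq (Runs.ite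
    (fun h2 => Runs.skip ?_) (fun h2 => Runs.const ?_)))))))) <;>
  refine Runs.storeCell (by simp [hs.r2]) (by simp [hs.r7]) (by simp; omega) (by omega)
    (by omega) ⟨_, by simp [hs.r0, hs.r4, hu, hv, add_assoc]; rfl, ?_⟩ <;>
  simp only [State.reg_setReg, State.reg_addr, hs.r0, hs.r3, hs.r5, hs.r7, hu, hv,
    Nat.reduceEqDiff, ↓reduceIte] at h1 h2 ⊢ <;>
  grind

end RAM

namespace RAM

theorem Runs.relaxCell {n k : ℕ} {s : State} (hs : Ready n k s) {l u v : ℕ} (hl : l < n)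
    (hu : u < n) (hrl : s.reg 13 = l) (hru : s.reg 14 = u) (hrv : s.reg 15 = v) :
    Runs RAM.relaxCell s (12 * n + 19) fun s' => s'.mem =
      Function.update s.mem (n * n + n * n + (u * n + v))
        (min (distances n s.mem (u * n + l) + distances n s.mem (l * n + v))
          (distances n s.mem (u * n + v))) := by
  refine Runs.mono (T := (3 * n + 4) + ((3 * n + 4) + (1 + ((3 * n + 4) + (1 + (1 +
    (3 * n + 4))))))) ?_ (by omega) fun _ _ h => h
  refine Runs.seq (Runs.loadCell hs.r2 hs.r7 (by omega) (by omega) ?_)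
  refine Runs.seq (Runs.loadCell (by simp [hs.r2]) (by simp [hs.r7]) (by simp; omega)
    (by omega) ?_)
  refine Runs.seq (Runs.add (Runs.seq ?_))
  refine Runs.loadCell (by simp [hs.r2]) (by simp [hs.r7]) (by simp; omega) (by omega) ?_
  refine Runs.seq (Runs.sub (Runs.seq (Runs.sub ?_)))
  refine Runs.storeCell (by simp [hs.r2]) (by simp [hs.r7]) (by simp; omega) (by omega)
    (by omega) ?_
  simp only [State.reg_setReg, State.reg_addr, hs.r0, hs.r4, hrl, hru, hrv, State.mem_setReg,
    State.mem_setMem, State.mem_addr, Nat.reduceEqDiff, ↓reduceIte, distances, add_assoc]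
  congr 1
  omega

theorem Runs.checkCell {n k : ℕ} {s : State} (hs : Ready n k s) {G : SimpleGraph (Fin n)}
    (hG : Enc 0 s.mem G) {u v : Fin n} (hu : s.reg 14 = u) (hv : s.reg 15 = v) :
    Runs RAM.checkCell s (6 * n + 12) fun s' =>
      (s'.mem = s.mem ∧ ¬ (G.Adj u v ∧ k < distances n s.mem (u * n + v))) ∨
      (s'.mem = Function.update s.mem (n * n + n * n + n * n) 1 ∧
        (G.Adj u v ∧ k < distances n s.mem (u * n + v))) := by
  have hlt := u.2
  have hcell : s.mem (0 + u * n + v) ≠ 0 ↔ G.Adj u v := hG.ne_zero_iff u v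
  refine Runs.mono (T := (3 * n + 4) + ((3 * n + 4) + (1 + (1 + 1 + 1)))) ?_ (by omega)
    fun _ _ h => h
  refine Runs.seq (Runs.loadCell hs.r2 hs.r7 (by omega) (by omega) ?_)
  refine Runs.seq (Runs.loadCell (by simp [hs.r2]) (by simp [hs.r7]) (by simp; omega)
    (by omega) ?_)
  refine Runs.seq (Runs.sub (Runs.ite (fun h1 => Runs.ite (fun h2 => Runs.store ?_)
    fun h2 => Runs.skip ?_) fun h1 => (Runs.skip ?_).mono (by omega) fun _ _ h => h)) <;>
  simp only [State.reg_setReg, State.reg_addr, hs.r0, hs.r1, hs.r2, hs.r4, hs.r6, hs.r7, hu, hv,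
    State.mem_setReg, State.mem_setMem, State.mem_addr, Nat.reduceEqDiff, ↓reduceIte, add_assoc,
    distances, OfNat.zero_ne_ofNat, OfNat.one_ne_ofNat] at h1 hcell ⊢
  · simp only [State.reg_setReg, State.reg_addr, hs.r0, hs.r1, hs.r4, hu, hv, State.mem_setReg,
      State.mem_addr, Nat.reduceEqDiff, ↓reduceIte, add_assoc, OfNat.zero_ne_ofNat,
      OfNat.one_ne_ofNat] at h2
    exact .inr ⟨trivial, hcell.1 h1, by omega⟩
  · simp only [State.reg_setReg, State.reg_addr, hs.r0, hs.r1, hs.r4, hu, hv, State.mem_setReg,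
      State.mem_addr, Nat.reduceEqDiff, ↓reduceIte, add_assoc, OfNat.zero_ne_ofNat,
      OfNat.one_ne_ofNat] at h2
    exact .inl ⟨trivial, fun h => by omega⟩
  · exact .inl ⟨trivial, fun h => hcell.2 h.1 h1⟩

/-- The two matrices are in place, and finite entries of the distance matrix are lengths of
walks. -/
structure Sound {n : ℕ} (k : ℕ) (G R : SimpleGraph (Fin n)) (μ : ℕ → ℕ) : Prop where
  encG : Enc 0 μ G
  encR : Enc (n * n) μ R
  edist_le : ∀ u v : Fin n, distances n μ (u * n + v) ≤ k →
    R.edist u v ≤ distances n μ (u * n + v)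

/-- The distance matrix is at most the length of each walk of length at most `r + 1`. -/
def Complete {n : ℕ} (R : SimpleGraph (Fin n)) (r : ℕ) (x : ℕ → ℕ) : Prop :=
  ∀ (u v : Fin n) (p : R.Walk u v), p.length ≤ r + 1 → x (u * n + v) ≤ p.length

/-- Split off the first edge of the walk and relax through its end. The bound `r + 1` in `Complete`
covers single edges already for `r = 0`. -/
theorem Complete.succ {n r : ℕ} {R : SimpleGraph (Fin n)} {x y : ℕ → ℕ} (h : Complete R r x)
    (hyx : y ≤ x) (hy : ∀ l < n, ∀ u < n, ∀ v < n, y (u * n + v) ≤ x (u * n + l) + x (l * n + v)) :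
    Complete R (r + 1) y := by
  intro u v p hp
  cases p with
  | nil => exact (hyx _).trans (h u u .nil (by simp))
  | @cons _ l _ hul p =>
    rw [SimpleGraph.Walk.length_cons] at hp ⊢
    have h1 := h u l hul.toWalk (by simp)
    have h2 := h l v p (by omega)
    have h3 := hy l l.2 u u.2 v v.2
    simp only [SimpleGraph.Walk.length_cons, SimpleGraph.Walk.length_nil] at h1
    omega

/-- A sum that is at most `k` has both summands at most `k`, so both are sound and the triangle
inequality applies. Larger entries carry no claim. -/
theorem Sound.relax {n k : ℕ} {G R : SimpleGraph (Fin n)} {μ : ℕ → ℕ} (h : Sound k G R μ)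
    {l u v : ℕ} (hl : l < n) (hu : u < n) (hv : v < n) :
    Sound k G R (Function.update μ (n * n + n * n + (u * n + v))
      (min (distances n μ (u * n + l) + distances n μ (l * n + v))
        (distances n μ (u * n + v)))) := by
  refine ⟨h.encG.update (by omega), h.encR.update (by omega), fun u' v' => ?_⟩
  rw [distances_update, Function.update_apply]
  split_ifs with heq
  · obtain ⟨rfl, rfl⟩ := cell_inj v'.2 hv heq
    intro hle
    rcases min_choice (distances n μ (u' * n + l) + distances n μ (l * n + v'))
      (distances n μ (u' * n + v')) with hm | hm
    · rw [hm] at hle ⊢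
      have h1 := h.edist_le u' ⟨l, hl⟩ (by simp only; omega)
      have h2 := h.edist_le ⟨l, hl⟩ v' (by simp only; omega)
      refine SimpleGraph.edist_triangle.trans ((add_le_add h1 h2).trans (le_of_eq ?_))
      push_cast
      rfl
    · rw [hm] at hle ⊢
      exact h.edist_le u' v' hle
  · exact h.edist_le u' v'

/-- `P` for all positions `(reg 14, reg 15)`. -/
def forCells (P : Prog) : Prog := .forN 14 0 (.forN 15 0 P)

theorem Runs.forCells {α : Type*} [Preorder α] (φ : (ℕ → ℕ) → α) (J : (ℕ → ℕ) → Prop)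
    (Q : ℕ → ℕ → α → Prop) (hQ : ∀ u v x y, x ≤ y → Q u v y → Q u v x)
    {P : Prog} {s : State} {n k T : ℕ} (hs : Ready n k s)
    (hw : ∀ q < 16, q ∉ P.writes) (h0 : J s.mem)
    (hbody : ∀ u < n, ∀ v < n, ∀ s' : State, Ready n k s' → s'.reg 13 = s.reg 13 →
      s'.reg 14 = u → s'.reg 15 = v → J s'.mem →
      Runs P s' T fun s'' => J s''.mem ∧ φ s''.mem ≤ φ s'.mem ∧ Q u v (φ s''.mem)) :
    Runs (RAM.forCells P) s (n * (n * (T + 2) + 2 + 2) + 2) fun s' =>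
      J s'.mem ∧ φ s'.mem ≤ φ s.mem ∧ ∀ u < n, ∀ v < n, Q u v (φ s'.mem) := by
  have hw' : ∀ q < 15, q ∉ (Prog.forN 15 0 P).writes := fun q hq => by
    have := hw q (by omega)
    simp only [Prog.forN, Prog.writes, List.mem_append, List.mem_singleton, not_or]
    exact ⟨by omega, by omega, this⟩
  refine Runs.forN_forall φ J (fun u x => ∀ v < n, Q u v x)
    (fun u x y hxy h v hv => hQ u v x y hxy (h v hv)) hs.r0 hs.r2 hs.r7
    ⟨by omega, hw' 14 (by omega), hw' 2 (by omega)⟩ h0 fun u hu s₁ hs₁ hu₁ hJ₁ => ?_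
  have hR₁ : Ready n k s₁ := hs.of_frame hs₁ fun q hq => ⟨by omega, hw' q (by omega)⟩
  refine Runs.forN_forall φ J (Q u) (hQ u) hR₁.r0 hR₁.r2 hR₁.r7
    ⟨by omega, hw 15 (by omega), hw 2 (by omega)⟩ hJ₁ fun v hv s₂ hs₂ hv₂ hJ₂ => ?_
  have hR₂ : Ready n k s₂ := hR₁.of_frame hs₂ fun q hq => ⟨by omega, hw q (by omega)⟩
  exact hbody u hu v hv s₂ hR₂
    ((hs₂ 13 (by omega) (hw 13 (by omega))).trans (hs₁ 13 (by omega) (hw' 13 (by omega))))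
    ((hs₂ 14 (by omega) (hw 14 (by omega))).trans hu₁) hv₂ hJ₂

theorem Runs.initCells {n k : ℕ} {s : State} (hs : Ready n k s) {G R : SimpleGraph (Fin n)}
    (hG : Enc 0 s.mem G) (hR : Enc (n * n) s.mem R) :
    Runs (RAM.forCells RAM.initCell) s (n * (n * (6 * n + 15 + 2) + 2 + 2) + 2) fun s' =>
      Sound k G R s'.mem ∧ Complete R 0 (distances n s'.mem) := by
  let good (u v : Fin n) (x : ℕ) : Prop :=
    (u = v → x = 0) ∧ (u ≠ v → R.Adj u v → x = 1) ∧ (u ≠ v → ¬ R.Adj u v → x = k + 1)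
  refine (Runs.forCells
    -- The descending quantity is the set of cells not yet correct.
    (φ := fun μ => {p : Fin n × Fin n | ¬ good p.1 p.2 (distances n μ (p.1 * n + p.2))})
    (J := fun μ => Enc 0 μ G ∧ Enc (n * n) μ R)
    (Q := fun u v x => ∀ (hu : u < n) (hv : v < n), ((⟨u, hu⟩, ⟨v, hv⟩) : Fin n × Fin n) ∉ x)
    (fun u v x y hxy h hu hv hx => h hu hv (Set.mem_of_subset_of_mem hxy hx)) hs (by decide) ⟨hG, hR⟩
    fun u hu v hv s₁ hs₁ _ hu₁ hv₁ hJ => ?_).mono le_rfl fun s' _ h => ?_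
  · refine (Runs.initCell hs₁ hJ.2 (u := ⟨u, hu⟩) (v := ⟨v, hv⟩) hu₁ hv₁).mono le_rfl ?_
    rintro s' - ⟨x, hx, hgood⟩
    rw [hx]
    refine ⟨⟨hJ.1.update (by omega), hJ.2.update (by omega)⟩, fun p hp => ?_, fun _ _ h => h ?_⟩
    · simp only [Set.mem_ofPred_eq, distances_update, Function.update_apply] at hp ⊢
      split_ifs at hp with heq
      · obtain ⟨h1, h2⟩ := cell_inj p.2.2 hv heq
        have h1 : p.1 = ⟨u, hu⟩ := Fin.ext h1
        have h2 : p.2 = ⟨v, hv⟩ := Fin.ext h2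
        rw [h1, h2] at hp
        exact absurd hgood hp
      · exact hp
    · simp only [distances_update, Function.update_apply, if_true]
      exact hgood
  · obtain ⟨⟨hG', hR'⟩, -, hall⟩ := h
    have hgood : ∀ u v : Fin n, good u v (distances n s'.mem (u * n + v)) := fun u v => by
      have := hall u u.2 v v.2 u.2 v.2
      simpa using this
    refine ⟨⟨hG', hR', fun u v hle => ?_⟩, fun u v p hp => ?_⟩
    · obtain ⟨h1, h2, h3⟩ := hgood u v
      by_cases huv : u = v
      · simp [huv]
      · by_cases hadj : R.Adj u v
        · rw [h2 huv hadj, SimpleGraph.edist_eq_one_iff_adj.2 hadj]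
          simp
        · have := h3 huv hadj
          omega
    · obtain ⟨h1, h2, h3⟩ := hgood u v
      by_cases huv : u = v
      · rw [h1 huv]; omega
      · rcases Nat.lt_or_ge p.length 1 with h0 | h0
        · exact absurd (SimpleGraph.Walk.eq_of_length_eq_zero (p := p) (by omega)) huv
        · have := h2 huv (p.adj_of_length_eq_one (by omega))
          omega

/-- One round of relaxations through all vertices. -/
def relaxRound : Prog := .forN 13 0 (forCells relaxCell)

theorem Runs.relaxRound {n k r : ℕ} {s : State} (hs : Ready n k s) {G R : SimpleGraph (Fin n)}
    (hS : Sound k G R s.mem) (hC : Complete R r (distances n s.mem)) :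
    Runs RAM.relaxRound s (n * (n * (n * (12 * n + 19 + 2) + 2 + 2) + 2 + 2) + 2) fun s' =>
      Sound k G R s'.mem ∧ Complete R (r + 1) (distances n s'.mem) := by
  -- Relaxation works in place, but entries only decrease; so every bound in terms of the matrix `x`
  -- at the start of the round remains valid.
  set x := distances n s.mem with hx
  refine (Runs.forN_forall (distances n) (fun μ => Sound k G R μ ∧ distances n μ ≤ x)
    (fun l y => ∀ u < n, ∀ v < n, y (u * n + v) ≤ x (u * n + l) + x (l * n + v))
    (fun l y z hyz h u hu v hv => (hyz _).trans (h u hu v hv)) hs.r0 hs.r2 hs.r7 (by decide)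
    ⟨hS, le_rfl⟩ fun l hl s₁ hs₁ hl₁ hJ₁ => ?_).mono le_rfl
    fun s' _ h => ⟨h.1.1, hC.succ h.1.2 h.2.2⟩
  have hR₁ : Ready n k s₁ := hs.of_frame hs₁ (by decide)
  refine Runs.forCells (distances n) (fun μ => Sound k G R μ ∧ distances n μ ≤ x)
    (fun u v y => y (u * n + v) ≤ x (u * n + l) + x (l * n + v))
    (fun u v y z hyz h => (hyz _).trans h) hR₁ (by decide) hJ₁
    fun u hu v hv s₂ hR₂ hl₂ hu₂ hv₂ hJ₂ => ?_
  refine (Runs.relaxCell hR₂ hl hu (hl₂.trans hl₁) hu₂ hv₂).mono le_rfl fun s' _ h => ?_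
  rw [h]
  have hle : distances n (Function.update s₂.mem (n * n + n * n + (u * n + v))
      (min (distances n s₂.mem (u * n + l) + distances n s₂.mem (l * n + v))
        (distances n s₂.mem (u * n + v)))) ≤ distances n s₂.mem := by
    intro a
    rw [distances_update, Function.update_apply]
    split_ifs with ha
    · rw [ha]; exact min_le_right _ _
    · exact le_rfl
  refine ⟨⟨hJ₂.1.relax hl hu hv, hle.trans hJ₂.2⟩, hle, ?_⟩
  rw [distances_update, Function.update_self]
  exact (min_le_left _ _).trans (add_le_add (hJ₂.2 _) (hJ₂.2 _))

/-- Compute the distance matrix. -/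
def computeDistances : Prog := .seq (forCells initCell) (.forN 12 0 relaxRound)

theorem Runs.computeDistances {n k : ℕ} {s : State} (hs : Ready n k s)
    {G R : SimpleGraph (Fin n)} (hG : Enc 0 s.mem G) (hR : Enc (n * n) s.mem R) :
    Runs RAM.computeDistances s (n * (n * (6 * n + 15 + 2) + 2 + 2) + 2 +
      (n * (n * (n * (n * (12 * n + 19 + 2) + 2 + 2) + 2 + 2) + 2 + 2) + 2)) fun s' =>
      Sound k G R s'.mem ∧ Complete R n (distances n s'.mem) := by
  refine Runs.seq ((Runs.initCells hs hG hR).mono le_rfl fun s₁ hs₁ h₁ => ?_)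
  have hR₁ : Ready n k s₁ := hs.of_eq fun q hq => hs₁ q (by revert q; decide)
  -- The loop counts down: `m` rounds remain, so `n - m` are done.
  refine (Runs.forN (I := fun m μ => Sound k G R μ ∧ Complete R (n - m) (distances n μ))
    hR₁.r0 hR₁.r2 hR₁.r7 (by decide) ⟨h₁.1, by rw [Nat.sub_self]; exact h₁.2⟩
    fun m hm s₂ hs₂ _ hI => ?_).mono le_rfl fun s' _ h => h
  have hR₂ : Ready n k s₂ := hR₁.of_frame hs₂ (by decide)
  have := Runs.relaxRound hR₂ hI.1 hI.2
  rwa [show n - (m + 1) + 1 = n - m by omega] at this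

/-- Test whether the second graph has stretch at most `k`; the answer is a zero in the cell after
the distance matrix. -/
def testStretch : Prog :=
  .seq computeDistances (.seq (.store 6 7) (forCells checkCell))

/-- A geodesic is a path, hence has fewer than `n` edges and is seen by `Complete R n`. -/
theorem Sound.exists_lt_iff {n k : ℕ} {G R : SimpleGraph (Fin n)} {μ : ℕ → ℕ}
    (hS : Sound k G R μ) (hC : Complete R n (distances n μ)) :
    (∀ u v : Fin n, ¬ (G.Adj u v ∧ k < distances n μ (u * n + v))) ↔ Stretch k G R := by
  refine ⟨fun h x y hxy => ?_, fun h x y hxy => ?_⟩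
  · have h1 : distances n μ (x * n + y) ≤ k := not_lt.1 fun h' => h x y ⟨hxy, h'⟩
    exact (hS.edist_le x y h1).trans (by exact_mod_cast h1)
  · have h1 := h x y hxy.1
    have hr := SimpleGraph.reachable_of_edist_ne_top (ne_top_of_le_ne_top (ENat.natCast_ne_top k) h1)
    obtain ⟨p, hp, hl⟩ := hr.exists_path_of_dist
    have h2 := hp.length_lt
    rw [Fintype.card_fin] at h2
    have h3 := hC x y p (by omega)
    rw [← hr.coe_dist_eq_edist, ← hl] at h1
    have h4 : p.length ≤ k := by exact_mod_cast h1
    have := hxy.2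
    omega

theorem Runs.testStretch {n k : ℕ} {s : State} (hs : Ready n k s)
    {G R : SimpleGraph (Fin n)} (hG : Enc 0 s.mem G) (hR : Enc (n * n) s.mem R) :
    Runs RAM.testStretch s (n * (n * (6 * n + 15 + 2) + 2 + 2) + 2 +
      (n * (n * (n * (n * (12 * n + 19 + 2) + 2 + 2) + 2 + 2) + 2 + 2) + 2) +
      (1 + (n * (n * (6 * n + 12 + 2) + 2 + 2) + 2))) fun s' =>
      Enc 0 s'.mem G ∧ Enc (n * n) s'.mem R ∧
        (s'.mem (n * n + n * n + n * n) = 0 ↔ Stretch k G R) := by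
  refine Runs.seq ((Runs.computeDistances hs hG hR).mono le_rfl fun s₁ hs₁ h₁ => ?_)
  have hR₁ : Ready n k s₁ := hs.of_eq fun q hq => hs₁ q (by revert q; decide)
  refine Runs.seq (Runs.store ?_)
  rw [hR₁.r6, hR₁.r7]
  set s₂ := s₁.setMem (n * n + n * n + n * n) 0 with hs₂
  have hR₂ : Ready n k s₂ := hR₁.of_eq fun q _ => rfl
  set x := distances n s₁.mem with hx
  let bad (u v : ℕ) : Prop :=
    ∃ (hu : u < n) (hv : v < n), G.Adj ⟨u, hu⟩ ⟨v, hv⟩ ∧ k < x (u * n + v)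
  have hupd : ∀ (μ : ℕ → ℕ) (c : ℕ), (∀ a < n * n, distances n μ a = x a) → ∀ a < n * n,
      distances n (Function.update μ (n * n + n * n + n * n) c) a = x a := by
    intro μ c h a ha
    rw [distances_update, Function.update_of_ne (by omega), h a ha]
  -- Propositions are ordered by implication: "the flag is still zero" only descends, since a raised
  -- flag is never lowered.
  refine (Runs.forCells (φ := fun μ => μ (n * n + n * n + n * n) = 0)
    (J := fun μ => (Enc 0 μ G ∧ Enc (n * n) μ R) ∧ (∀ a < n * n, distances n μ a = x a) ∧
      (μ (n * n + n * n + n * n) ≠ 0 → ∃ u v, bad u v))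
    (Q := fun u v p => bad u v → ¬ p) (fun u v p q hpq h hb hp => h hb ((show p → q from hpq) hp))
    hR₂ (by decide) ?_ fun u hu v hv s₃ hR₃ _ hu₃ hv₃ hJ => ?_).mono le_rfl
    fun s' _ h => ⟨h.1.1.1, h.1.1.2, ?_⟩
  · refine ⟨⟨h₁.1.encG.update (by omega), h₁.1.encR.update (by omega)⟩,
      hupd _ _ fun _ _ => rfl, fun h => ?_⟩
    simp [hs₂] at h
  · have hx₃ := hJ.2.1 _ (cell_lt hu hv)
    refine (Runs.checkCell hR₃ hJ.1.1 (u := ⟨u, hu⟩) (v := ⟨v, hv⟩) hu₃ hv₃).mono le_rfl ?_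
    rintro s' - (⟨h1, h2⟩ | ⟨h1, h2⟩)
    · rw [h1]
      refine ⟨hJ, le_rfl, fun hb _ => h2 ?_⟩
      rw [hx₃]
      exact ⟨hb.2.2.1, hb.2.2.2⟩
    · rw [h1]
      refine ⟨⟨⟨hJ.1.1.update (by omega), hJ.1.2.update (by omega)⟩, hupd _ _ hJ.2.1,
        fun _ => ⟨u, v, hu, hv, h2.1, by rw [← hx₃]; exact h2.2⟩⟩, fun h => ?_, fun _ h => ?_⟩
      · simp at h
      · simp at h
  · rw [← h₁.1.exists_lt_iff h₁.2]
    constructor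
    · intro h0 u v hb
      exact h.2.2 u u.2 v v.2 ⟨u.2, v.2, hb.1, hb.2⟩ h0
    · intro hall
      by_contra h0
      obtain ⟨u, v, hu, hv, hb⟩ := h.1.2.2 h0
      exact hall ⟨u, hu⟩ ⟨v, hv⟩ hb

end RAM

namespace RAM

open SimpleGraph

/-! ### The pruning algorithm -/

theorem Enc.update₂ {n base c : ℕ} {μ : ℕ → ℕ} {R R' : SimpleGraph (Fin n)} (h : Enc base μ R)
    {i j : Fin n} (hR' : ∀ a b, s(a, b) ≠ s(i, j) → (R'.Adj a b ↔ R.Adj a b))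
    (hc : R'.Adj i j ∧ c = 1 ∨ ¬ R'.Adj i j ∧ c = 0) :
    Enc base (Function.update (Function.update μ (base + i * n + j) c) (base + j * n + i) c)
      R' := by
  classical
  have hval : ∀ a b : Fin n, s(a, b) = s(i, j) → c = if R'.Adj a b then 1 else 0 := by
    intro a b hab
    have : R'.Adj a b ↔ R'.Adj i j := by
      rw [← mem_edgeSet, hab, mem_edgeSet]
    rcases hc with ⟨h1, rfl⟩ | ⟨h1, rfl⟩
    · rw [if_pos (this.2 h1)]
    · rw [if_neg (mt this.1 h1)]
  intro a b
  by_cases h1 : base + (a : ℕ) * n + b = base + j * n + i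
  · obtain ⟨e1, e2⟩ := cell_inj b.2 i.2 (show (a : ℕ) * n + b = j * n + i by omega)
    rw [h1, Function.update_self]
    convert hval a b (by rw [Fin.ext e1, Fin.ext e2, Sym2.eq_swap])
  rw [Function.update_of_ne h1]
  by_cases h2 : base + (a : ℕ) * n + b = base + i * n + j
  · obtain ⟨e1, e2⟩ := cell_inj b.2 j.2 (show (a : ℕ) * n + b = i * n + j by omega)
    rw [h2, Function.update_self]
    convert hval a b (by rw [Fin.ext e1, Fin.ext e2])
  rw [Function.update_of_ne h2, h a b]
  refine if_congr (hR' a b fun hab => ?_).symm rfl rfl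
  rcases Sym2.eq_iff.1 hab with ⟨rfl, rfl⟩ | ⟨rfl, rfl⟩
  · exact h2 rfl
  · exact h1 rfl

/-- The graph whose adjacency matrix is stored from address `n * n` on. -/
def decode (n : ℕ) (μ : ℕ → ℕ) : SimpleGraph (Fin n) where
  Adj i j := i ≠ j ∧ μ (n * n + i * n + j) ≠ 0 ∧ μ (n * n + j * n + i) ≠ 0
  symm := ⟨fun _ _ h => ⟨h.1.symm, h.2.2, h.2.1⟩⟩
  loopless := ⟨fun _ h => h.1 rfl⟩

theorem Enc.decode_eq {n : ℕ} {μ : ℕ → ℕ} {R : SimpleGraph (Fin n)} (h : Enc (n * n) μ R) :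
    decode n μ = R := by
  ext i j
  change i ≠ j ∧ _ ∧ _ ↔ _
  rw [h.ne_zero_iff, h.ne_zero_iff]
  exact ⟨fun h => h.2.1, fun h => ⟨h.ne, h, h.symm⟩⟩

/-- Delete the edge `(reg 10, reg 11)` of the second graph unless this spoils the stretch. -/
def pruneCell : Prog :=
  .seq (.loadCell 20 3 10 11) <|
  .ite 20 (.seq (.storeCell 3 10 11 7) <| .seq (.storeCell 3 11 10 7) <| .seq testStretch <|
    .seq (.load 20 6) <|
    .ite 20 (.seq (.storeCell 3 10 11 2) (.storeCell 3 11 10 2)) .skip) .skip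

/-- The running time of `testStretch`. -/
def testTime {α : Type*} [Semiring α] (n : α) : α :=
  n * (n * (6 * n + 15 + 2) + 2 + 2) + 2 +
    (n * (n * (n * (n * (12 * n + 19 + 2) + 2 + 2) + 2 + 2) + 2 + 2) + 2) +
    (1 + (n * (n * (6 * n + 12 + 2) + 2 + 2) + 2))

/-- The running time of `pruneCell`. -/
def pruneTime {α : Type*} [Semiring α] (n : α) : α :=
  (3 * n + 4) + ((3 * n + 4) + ((3 * n + 4) + (testTime n + (1 + (3 * n + 4 + (3 * n + 4) + 1))))
    + 1)

/-- `R'` is `R` or `R` without the edge. In the latter case the last clause is vacuous; if the edge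
is restored, it says that the test failed. -/
theorem Runs.pruneCell {n k : ℕ} {s : State} (hs : Ready n k s) {G R : SimpleGraph (Fin n)}
    (hG : Enc 0 s.mem G) (hR : Enc (n * n) s.mem R) {i j : Fin n} (hi : s.reg 10 = i)
    (hj : s.reg 11 = j) :
    Runs RAM.pruneCell s (pruneTime n) fun s' => ∃ R', Enc 0 s'.mem G ∧ Enc (n * n) s'.mem R' ∧
      R' ≤ R ∧ (Stretch k G R → Stretch k G R') ∧
      (R'.Adj i j → ¬ Stretch k G (R'.deleteEdges {s(i, j)})) := by
  have hin := i.2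
  have hjn := j.2
  have hcell := hR.ne_zero_iff i j
  have hlt := cell_lt i.2 j.2
  have hlt' := cell_lt j.2 i.2
  refine Runs.seq (Runs.loadCell hs.r2 hs.r7 (by omega) (by omega) ?_)
  refine Runs.ite (fun h => ?_) fun h => (Runs.skip ?_).mono (by omega) fun _ _ h => h
  · simp only [State.reg_setReg, hs.r0, hs.r3, hi, hj, ↓reduceIte] at h
    have hadj : R.Adj i j := hcell.1 h
    refine Runs.seq (Runs.storeCell (by simp [hs.r2]) (by simp [hs.r7]) (by simp; omega)
      (by omega) (by omega) ?_)
    refine Runs.seq (Runs.storeCell (by simp [hs.r2]) (by simp [hs.r7]) (by simp; omega)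
      (by omega) (by omega) ?_)
    refine Runs.seq ?_
    set s₁ := (State.setMem _ _ _ : State) with hs₁
    have hR₁ : Ready n k s₁ := hs.of_eq fun q hq => by
      rw [hs₁]
      simp only [State.reg_setReg, State.reg_addr, State.reg_setMem]
      rw [if_neg (by omega), if_neg (by omega), if_neg (by omega), if_neg (by omega),
        if_neg (by omega), if_neg (by omega), if_neg (by omega)]
    have hi₁ : s₁.reg 10 = i := by rw [hs₁]; simp [hi]
    have hj₁ : s₁.reg 11 = j := by rw [hs₁]; simp [hj]
    have hmem : s₁.mem = Function.update (Function.update s.mem (n * n + i * n + j) 0)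
        (n * n + j * n + i) 0 := by
      rw [hs₁]
      simp [hs.r0, hs.r3, hs.r7, hi, hj]
    clear_value s₁
    have hG₁ : Enc 0 s₁.mem G := by
      rw [hmem]
      exact (hG.update (by omega)).update (by omega)
    have henc₁ : Enc (n * n) s₁.mem (R.deleteEdges {s(i, j)}) := by
      rw [hmem]
      refine hR.update₂ (fun a b hab => ?_) (.inr ⟨?_, rfl⟩)
      · rw [deleteEdges_adj]
        exact ⟨fun h => h.1, fun h => ⟨h, hab⟩⟩
      · rw [deleteEdges_adj]
        exact fun h => h.2 rfl
    refine (Runs.testStretch hR₁ hG₁ henc₁).mono le_rfl fun s₂ hfr h₂ => ?_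
    have hR₂ : Ready n k s₂ := hR₁.of_eq fun q hq => hfr q (by revert q; decide)
    have hi₂ : s₂.reg 10 = i := (hfr 10 (by decide)).trans hi₁
    have hj₂ : s₂.reg 11 = j := (hfr 11 (by decide)).trans hj₁
    obtain ⟨hG₂, henc₂, hflag⟩ := h₂
    refine Runs.seq (Runs.load (Runs.ite (fun h => ?_)
      fun h => (Runs.skip ?_).mono (by omega) fun _ _ h => h))
    · simp only [State.reg_setReg, hR₂.r6, ↓reduceIte] at h
      refine Runs.seq (Runs.storeCell (by simp [hR₂.r2]) (by simp [hR₂.r7]) (by simp; omega)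
        (by omega) (by omega) ?_)
      refine Runs.storeCell (by simp [hR₂.r2]) (by simp [hR₂.r7]) (by simp; omega)
        (by omega) (by omega) ?_
      refine ⟨R, ?_, ?_, le_rfl, id, fun _ h' => h (hflag.2 h')⟩
      · simp only [State.reg_setReg, State.reg_addr, State.mem_setReg, State.mem_setMem,
          State.mem_addr, State.reg_setMem, Nat.reduceEqDiff, ↓reduceIte, hR₂.r0, hR₂.r3, hi₂, hj₂,
          OfNat.zero_ne_ofNat]
        exact (hG₂.update (by omega)).update (by omega)
      · simp only [State.reg_setReg, State.reg_addr, State.mem_setReg, State.mem_setMem,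
          State.mem_addr, State.reg_setMem, Nat.reduceEqDiff, ↓reduceIte, hR₂.r0, hR₂.r2, hR₂.r3,
          hi₂, hj₂, OfNat.zero_ne_ofNat]
        refine henc₂.update₂ (fun a b hab => ?_) (.inl ⟨hadj, rfl⟩)
        rw [deleteEdges_adj]
        exact ⟨fun h => ⟨h, hab⟩, fun h => h.1⟩
    · simp only [State.reg_setReg, hR₂.r6, ↓reduceIte] at h
      refine ⟨R.deleteEdges {s(i, j)}, hG₂, henc₂, deleteEdges_le _, fun _ => hflag.1 h,
        fun h => ?_⟩
      rw [deleteEdges_adj] at h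
      exact absurd rfl h.2
  · simp only [State.reg_setReg, hs.r0, hs.r3, hi, hj, ↓reduceIte] at h
    exact ⟨R, hG, hR, le_rfl, id, fun h' => absurd h (hcell.2 h')⟩

/-- Prune all edges one after the other. -/
def prune : Prog := .forN 10 0 (.forN 11 0 pruneCell)

theorem Runs.prune {n k : ℕ} {s : State} (hs : Ready n k s) {G H : SimpleGraph (Fin n)}
    (hG : Enc 0 s.mem G) (hH : Enc (n * n) s.mem H) :
    Runs RAM.prune s (n * (n * (pruneTime n + 2) + 2 + 2) + 2) fun s' =>
      ∃ R, Enc (n * n) s'.mem R ∧ R ≤ H ∧ (Stretch k G H → Stretch k G R) ∧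
        ∀ i j, R.Adj i j → ¬ Stretch k G (R.deleteEdges {s(i, j)}) := by
  -- Through `decode` the current graph is a function of the memory and can serve as the descending
  -- quantity of the loops.
  let J (μ : ℕ → ℕ) : Prop := Enc 0 μ G ∧ Enc (n * n) μ (decode n μ) ∧ decode n μ ≤ H ∧
    (Stretch k G H → Stretch k G (decode n μ))
  let Q (i j : ℕ) (R : SimpleGraph (Fin n)) : Prop := ∀ (hi : i < n) (hj : j < n),
    R.Adj ⟨i, hi⟩ ⟨j, hj⟩ → ¬ Stretch k G (R.deleteEdges {s(⟨i, hi⟩, ⟨j, hj⟩)})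
  -- An edge that is necessary in `R'` stays necessary in every subgraph containing it, since
  -- stretch passes to supergraphs. One pass over the edges is therefore enough.
  have hQ : ∀ i j R R', R ≤ R' → Q i j R' → Q i j R := fun i j R R' hR h hi hj hadj hst =>
    h hi hj (hR hadj) (hst.mono fun a b hab => by
      rw [deleteEdges_adj] at hab ⊢
      exact ⟨hR hab.1, hab.2⟩)
  have hJ : J s.mem := by
    refine ⟨hG, ?_, ?_, ?_⟩ <;> rw [hH.decode_eq]
    · exact hH
    · exact id
  refine (Runs.forN_forall (decode n) J (fun i R => ∀ j < n, Q i j R)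
    (fun i R R' hR h j hj => hQ i j R R' hR (h j hj)) hs.r0 hs.r2 hs.r7 (by decide) hJ
    fun i hi s₁ hs₁ hi₁ hJ₁ => ?_).mono le_rfl fun s' _ h => ⟨decode n s'.mem, h.1.2.1, h.1.2.2.1,
      h.1.2.2.2, fun i j => h.2.2 i i.2 j j.2 i.2 j.2⟩
  have hR₁ : Ready n k s₁ := hs.of_frame hs₁ (by decide)
  refine Runs.forN_forall (decode n) J (Q i) (hQ i) hR₁.r0 hR₁.r2 hR₁.r7 (by decide) hJ₁
    fun j hj s₂ hs₂ hj₂ hJ₂ => ?_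
  have hR₂ : Ready n k s₂ := hR₁.of_frame hs₂ (by decide)
  refine (Runs.pruneCell hR₂ hJ₂.1 hJ₂.2.1 (i := ⟨i, hi⟩) (j := ⟨j, hj⟩)
    ((hs₂ 10 (by decide) (by decide)).trans hi₁) hj₂).mono le_rfl ?_
  rintro s' - ⟨R', h1, h2, h3, h4, h5⟩
  have hdec := h2.decode_eq
  refine ⟨⟨h1, hdec ▸ h2, hdec ▸ h3.trans hJ₂.2.2.1, fun h => hdec ▸ h4 (hJ₂.2.2.2 h)⟩,
    hdec ▸ h3, fun _ _ => ?_⟩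
  rw [hdec]
  exact h5

/-- Copy the second matrix onto the first one. -/
def copyBack : Prog := .forN 10 3 (.seq (.add 20 3 10) (.seq (.load 21 20) (.store 10 21)))

theorem Runs.copyBack {n k : ℕ} {s : State} (hs : Ready n k s) {R : SimpleGraph (Fin n)}
    (hR : Enc (n * n) s.mem R) :
    Runs RAM.copyBack s (n * n * (3 + 2) + 2) fun s' => Outputs s' R := by
  -- All writes go below address `n * n`, so the block being copied stays intact.
  refine (Runs.forN (I := fun m μ => (∀ a < n * n, μ (n * n + a) = s.mem (n * n + a)) ∧
    ∀ a, m ≤ a → a < n * n → μ a = s.mem (n * n + a)) hs.r3 hs.r2 hs.r7 (by decide)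
    ⟨fun _ _ => rfl, fun a h1 h2 => absurd h2 (by omega)⟩ fun m hm s' hs' hr hI => ?_).mono le_rfl
    fun s' _ h i j => ?_
  · have h3 : s'.reg 3 = n * n := (hs' 3 (by decide) (by decide)).trans hs.r3
    refine Runs.seq (T := 1) (T' := 2) (Runs.add (Runs.seq (T := 1) (T' := 1) (Runs.load
      (Runs.store ?_))))
    simp only [State.reg_setReg, State.mem_setReg, State.mem_setMem, Nat.reduceEqDiff, ↓reduceIte,
      h3, hr]
    refine ⟨fun a ha => ?_, fun a h1 h2 => ?_⟩
    · rw [Function.update_of_ne (by omega), hI.1 a ha]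
    · rw [Function.update_apply]
      split_ifs with ha
      · rw [ha, hI.1 m hm]
      · exact hI.2 a (by omega) h2
  · rw [h.2 _ (Nat.zero_le _) (cell_lt i.2 j.2), ← add_assoc, hR i j]

/-- Load the constants. -/
def setup : Prog :=
  -- With base and column zero and row `n`, the address computation yields the product `n * n`.
  .seq (.const 2 1) <| .seq (.addr 20 7 0 7) <| .seq (.add 3 20 7) <| .seq (.add 4 3 3) <|
  .seq (.add 6 4 3) (.add 5 1 2)

theorem Runs.setup {n k : ℕ} (G H : SimpleGraph (Fin n)) :
    Runs RAM.setup (input G H k) (3 * n + 8) fun s => Ready n k s ∧ s.mem = (input G H k).mem := by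
  refine Runs.mono (T := 1 + ((3 * n + 3) + (1 + (1 + (1 + 1))))) (Runs.seq (Runs.const
    (Runs.seq (Runs.addr (by simp) (by simp [input]) (by simp [input]) (by omega)
    (Runs.seq (Runs.add (Runs.seq (Runs.add (Runs.seq (Runs.add (Runs.add ?_)))))))))))
    (by omega) fun _ _ h => h
  refine ⟨⟨?_, ?_, ?_, ?_, ?_, ?_, ?_, ?_⟩, ?_⟩ <;> simp [input]

theorem enc_input {n k : ℕ} (G H : SimpleGraph (Fin n)) :
    Enc 0 (input G H k).mem G ∧ Enc (n * n) (input G H k).mem H := by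
  classical
  constructor <;> intro i j <;> have hij := cell_lt i.2 j.2 <;> simp only [input]
  · refine if_congr ⟨?_, fun h => ⟨i, j, .inl ⟨by omega, h⟩⟩⟩ rfl rfl
    rintro ⟨a, b, ⟨h1, h2⟩ | ⟨h1, h2⟩⟩
    · obtain ⟨e1, e2⟩ := cell_inj j.2 b.2 (show (i : ℕ) * n + j = a * n + b by omega)
      rwa [Fin.ext e1, Fin.ext e2]
    · omega
  · refine if_congr ⟨?_, fun h => ⟨i, j, .inr ⟨by omega, h⟩⟩⟩ rfl rfl
    rintro ⟨a, b, ⟨h1, h2⟩ | ⟨h1, h2⟩⟩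
    · have := cell_lt a.2 b.2
      omega
    · obtain ⟨e1, e2⟩ := cell_inj j.2 b.2 (show (i : ℕ) * n + j = a * n + b by omega)
      rwa [Fin.ext e1, Fin.ext e2]

/-- The whole algorithm: prune the edges of `H` one after the other. -/
def pruneSpanner : Prog := .seq setup (.seq prune copyBack)

/-- The running time of the algorithm. -/
def totalTime {α : Type*} [Semiring α] (n : α) : α :=
  3 * n + 8 + (n * (n * (pruneTime n + 2) + 2 + 2) + 2 + (n * n * (3 + 2) + 2))

theorem runs_pruneSpanner {n k : ℕ} (G H : SimpleGraph (Fin n)) :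
    Runs pruneSpanner (input G H k) (totalTime n) fun s => ∃ R, Outputs s R ∧ R ≤ H ∧
      (Stretch k G H → Stretch k G R) ∧
      ∀ i j, R.Adj i j → ¬ Stretch k G (R.deleteEdges {s(i, j)}) := by
  refine Runs.seq ((Runs.setup G H).mono le_rfl fun s₁ _ h₁ => ?_)
  obtain ⟨hR₁, hmem⟩ := h₁
  obtain ⟨hG, hH⟩ := enc_input (k := k) G H
  rw [← hmem] at hG hH
  refine Runs.seq ((Runs.prune hR₁ hG hH).mono le_rfl ?_)
  rintro s₂ hfr ⟨R, hR, h1, h2, h3⟩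
  have hR₂ : Ready n k s₂ := hR₁.of_eq fun q hq => hfr q (by revert q; decide)
  exact (Runs.copyBack hR₂ hR).mono le_rfl fun s₃ _ h => ⟨R, h, h1, h2, h3⟩

end RAM

/-! ### The main theorem -/

theorem isSpanner_iff_stretch {V : Type*} {k : ℕ} (hk : 0 < k) {G H : SimpleGraph V} :
    IsSpanner k G H ↔ H ≤ G ∧ RAM.Stretch k G H :=
  isSpanner_iff_adj hk

/-- There are one deterministic program `A` and one polynomial `p` such that `A` halts on every input
within `p(n)` steps, and for some constants `c` and `N`, for all `n ≥ N` and `k > 3n/4 + c`, on every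
`n`-vertex graph `G` with a `k`-spanner `H` the program outputs a subgraph of `H` that is a
`k`-spanner of `G` of girth at least `k + 2`; moreover `(n, k)` is extremely good. -/
theorem theorem1p6 :
    ∃ (A : RAM.Prog) (p : Polynomial ℕ),
      (∀ (n k : ℕ) (G H : SimpleGraph (Fin n)),
        ∃ (t : ℕ) (s : RAM.State), RAM.Exec A (RAM.input G H k) t s ∧ t ≤ p.eval n) ∧
      ∃ (c : ℝ) (N : ℕ), ∀ n : ℕ, N ≤ n → ∀ k : ℕ, 3 / 4 * (n : ℝ) + c < (k : ℝ) →
        (∀ G H : SimpleGraph (Fin n), IsSpanner k G H →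
          ∀ (t : ℕ) (s : RAM.State), RAM.Exec A (RAM.input G H k) t s →
            ∃ R : SimpleGraph (Fin n), RAM.Outputs s R ∧
              R ≤ H ∧ IsSpanner k G R ∧ ((k + 2 : ℕ) : ℕ∞) ≤ R.egirth) ∧
        IsExtremelyGood n k := by
  -- The running time is written over any semiring, so evaluating it at `Polynomial.X` gives the
  -- required polynomial.
  refine ⟨RAM.pruneSpanner, RAM.totalTime Polynomial.X, fun n k G H => ?_, 0, 0,
    fun n _ k hk => ?_⟩
  · obtain ⟨t, s, he, ht, -⟩ := RAM.runs_pruneSpanner (k := k) G H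
    refine ⟨t, s, he, ht.trans (le_of_eq ?_)⟩
    simp [RAM.totalTime, RAM.pruneTime, RAM.testTime]
  · have hk' : 3 * n < 4 * k := by
      have : (3 * n : ℝ) < 4 * k := by linarith
      exact_mod_cast this
    have hpos : 0 < k := by omega
    refine ⟨fun G H hH t s he => ?_, isExtremelyGood_of_lt hk'⟩
    obtain ⟨t', s', he', -, R, hout, hRH, hst, hmin⟩ := RAM.runs_pruneSpanner (k := k) G H
    -- Determinism identifies the given run with the one that was analysed.
    obtain ⟨-, rfl⟩ := he.deterministic he'
    have hH' := (isSpanner_iff_stretch hpos).1 hH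
    have hR : IsSpanner k G R := (isSpanner_iff_stretch hpos).2 ⟨hRH.trans hH'.1, hst hH'.2⟩
    refine ⟨R, hout, hRH, hR, hR.le_egirth (by rwa [Fintype.card_fin]) fun e he hS => ?_⟩
    induction e with | _ i j =>
    exact hmin i j he ((isSpanner_iff_stretch hpos).1 hS).2
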